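/- **Conventions.** A *curve* is a differentiable function $f:[a,b]\to\mathbb C$, $a<b$, whose derivative is absolutely continuous and nowhere zero. Its length is $\int_a^b|f'|$, and $[f]$ denotes its reparametrization by arclength; two curves are *equivalent*, $f\equiv g$, if $[f]=[g]$. Let $\kappa$ be the signed curvature of $f$ and $ds=|f'|\,dt$. The *bending energy* of $f$ is $\frac14\int\kappa^2\,ds\in[0,\infty]$ and its *turning angle* is $\int\kappa\,ds$. A *c-curve* is a curve with $\kappa\ge0$ almost everywhere (left) or $\kappa\le 0$ almost everywhere (right) whose turning angle has magnitude at most $\pi$. An *s-curve* is a c-curve, or a curve composed of two successive c-curves that turn in opposite directions (one left, one right, in either order). For $u=(u_1,u_2)$, $v=(v_1,v_2)\in\mathbb C^2$ with $|u_2|=|v_2|=1$, $S(u,v)$ is the set of all s-curves $f:[a,b]\to\mathbb C$ with $(f(a),f'(a)/|f'(a)|)=u$ and $(f(b),f'(b)/|f'(b)|)=v$. A curve $g$ is *directly similar* to $f$ if $g\equiv c_1f+c_2$ for some $c_1,c_2\in\mathbb C$ with $c_1\ne0$. *Rectangular elastica* is $E(t)=\sin t+i\,\xi(t)$, where $\xi(t)=\int_0^t\frac{\sin^2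 r}{\sqrt{1+\sin^2 r}}\,dr$, and $E_{[t_1,t_2]}$ is its restriction to $[t_1,t_2]$. Finally, for real $\alpha,\beta,\gamma$ put $$y_1(\gamma)=\tfrac12\int_0^{\alpha-\gamma}\sqrt{\sin\tau}\,d\tau,\qquad y_2(\gamma)=\tfrac12\int_0^{\beta-\gamma}\sqrt{\sin\tau}\,d\tau,$$ $$\sigma(\gamma)=\cos\gamma+\frac{\sin\gamma}{y_1(\gamma)+y_2(\gamma)}\left(\sqrt{\sin(\alpha-\gamma)}+\sqrt{\sin(\beta-\gamma)}\right),$$ used here only at $\gamma=\beta$. **Theorem 6.2.** Let $\alpha\in(0,\pi)$ and $\beta<0$ satisfy $|\beta|\le\alpha$ and $\beta>\alpha-\pi$, put $u=(0,e^{i\alpha})$ and $v=(1,e^{i\beta})$, and suppose $\sigma(\beta)\le0$. Then there exist $-\pi<t_1<t_2\le0$ and a curve $f\in S(u,v)$ such that $E_{[t_1,t_2]}$ is directly similar to $f$, $f$ has minimal bending energy in $S(u,v)$, and every curve in $S(u,v)$ of minimal bending energy is equivalent to $f$. -/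

import Mathlib

open Set MeasureTheory

noncomputable section

namespace ElasticSpline

/-- A parametrized arc in the complex plane: an interval `[a, b]` and a function, of which only the
values on `[a, b]` matter. It is a curve when `IsCurve` below holds. -/
structure Arc where
  a : ℝ
  b : ℝ
  toFun : ℝ → ℂ

namespace Arc

/-- The derivative `f'`, taken relative to `[a, b]` (one-sided at the end points). -/
def d1 (f : Arc) : ℝ → ℂ := derivWithin f.toFun (Icc f.a f.b)

/-- The second derivative `f''` relative to `[a, b]`; for a curve it exists almost everywhere. -/
def d2 (f : Arc) : ℝ → ℂ := derivWithin f.d1 (Icc f.a f.b)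

/-- A curve is a differentiable function on `[a, b]` with absolutely continuous, nowhere vanishing
derivative. -/
structure IsCurve (f : Arc) : Prop where
  lt : f.a < f.b
  differentiableOn : DifferentiableOn ℝ f.toFun (Icc f.a f.b)
  absolutelyContinuous : AbsolutelyContinuousOnInterval f.d1 f.a f.b
  d1_ne_zero : ∀ t ∈ Icc f.a f.b, f.d1 t ≠ 0

/-- The arclength `∫_a^t |f'|` from the initial point to the point with parameter `t`. -/
def arclength (f : Arc) (t : ℝ) : ℝ := ∫ r in f.a..t, ‖f.d1 r‖

/-- The length of `f`. -/
def len (f : Arc) : ℝ := f.arclength f.b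

/-- The unit speed curve `[f]` described by `f`, defined on `[0, len f]`: its value at `s` is `f t`
for the parameter `t ∈ [a, b]` with arclength `s`. -/
def unitSpeed (f : Arc) (s : ℝ) : ℂ :=
  f.toFun (Function.invFunOn f.arclength (Icc f.a f.b) s)

/-- Two curves are equivalent if they describe the same unit speed curve. -/
def Equivalent (f g : Arc) : Prop :=
  f.len = g.len ∧ EqOn f.unitSpeed g.unitSpeed (Icc 0 f.len)

/-- The signed curvature `Im (conj f' * f'') / |f'|^3` at the parameter `t`, that is, the derivative
of the direction angle with respect to arclength (see `curvature_mul_speed`). -/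
def curvature (f : Arc) (t : ℝ) : ℝ :=
  ((starRingEnd ℂ) (f.d1 t) * f.d2 t).im / ‖f.d1 t‖ ^ 3

/-- If `τ` is a direction angle of `f`, that is, `f' = |f'| e^{iτ}`, then `κ ds/dt = dτ/dt`. -/
theorem curvature_mul_speed {f : Arc} (hf : f.IsCurve) {τ : ℝ → ℝ}
    (hdir : ∀ s ∈ Icc f.a f.b, f.d1 s = ‖f.d1 s‖ * Complex.exp (τ s * Complex.I))
    {t : ℝ} (ht : t ∈ Icc f.a f.b) (h1 : DifferentiableWithinAt ℝ f.d1 (Icc f.a f.b) t)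
    (hτ : DifferentiableWithinAt ℝ τ (Icc f.a f.b) t) :
    f.curvature t * ‖f.d1 t‖ = derivWithin τ (Icc f.a f.b) t := by
  have hu := uniqueDiffOn_Icc hf.lt t ht
  have hn : ‖f.d1 t‖ ≠ 0 := norm_ne_zero_iff.mpr (hf.d1_ne_zero t ht)
  have hD1 : HasDerivWithinAt f.d1 (f.d2 t) (Icc f.a f.b) t := h1.hasDerivWithinAt
  have hDτ := hτ.hasDerivWithinAt
  have hE := ((hDτ.ofReal_comp.neg.mul_const Complex.I).cexp)
  have hv := hD1.mul hE
  have him := (Complex.imCLM.hasFDerivAt.comp_hasDerivWithinAt t hv)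
  have hcancel : ∀ s, Complex.exp (τ s * Complex.I) * Complex.exp (-(τ s : ℂ) * Complex.I) = 1 := by
    intro s
    rw [← Complex.exp_add]
    simp
  have h0 : HasDerivWithinAt (fun _ : ℝ => (0 : ℝ)) 0 (Icc f.a f.b) t :=
    hasDerivWithinAt_const _ _ _
  have him0 := h0.congr_of_mem
    (f₁ := Complex.imCLM ∘ (f.d1 * fun x => Complex.exp (-(τ x : ℂ) * Complex.I)))
    (fun s hs => by
      simp only [Function.comp, Pi.mul_apply, Complex.imCLM_apply]
      rw [hdir s hs, mul_assoc, hcancel]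
      simp) ht
  have key := hu.eq_deriv _ him him0
  have hc : (starRingEnd ℂ) (f.d1 t) = ‖f.d1 t‖ * Complex.exp (-(τ t : ℂ) * Complex.I) := by
    conv_lhs => rw [hdir t ht]
    rw [map_mul, ← Complex.exp_conj]
    simp
  set n := ‖f.d1 t‖ with hndef
  set e := Complex.exp (-(τ t : ℂ) * Complex.I) with he
  set τ' := derivWithin τ (Icc f.a f.b) t
  have h3 : f.d1 t * e = n := by
    rw [hdir t ht, mul_assoc, hcancel]
    simp [hndef]
  have key2 : (f.d2 t * e).im = τ' * n := by
    have h4 : f.d1 t * (e * (-(τ' : ℂ) * Complex.I)) = n * (-(τ' : ℂ) * Complex.I) := by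
      rw [← mul_assoc, h3]
    have key' : (f.d2 t * e + f.d1 t * (e * (-(τ' : ℂ) * Complex.I))).im = 0 := key
    rw [h4] at key'
    simp only [Complex.add_im, Complex.mul_im, Complex.mul_re, Complex.neg_re, Complex.neg_im,
      Complex.ofReal_re, Complex.ofReal_im, Complex.I_re, Complex.I_im] at key' ⊢
    linarith
  have h5 : ((starRingEnd ℂ) (f.d1 t) * f.d2 t).im = n * (τ' * n) := by
    rw [hc, ← key2, mul_assoc, mul_comm e, Complex.im_ofReal_mul]
  unfold curvature
  rw [h5, ← hndef]
  field_simp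

/-- The turning angle `Δ(f) = ∫ κ ds`. -/
def turning (f : Arc) : ℝ := ∫ t in f.a..f.b, f.curvature t * ‖f.d1 t‖

/-- The bending energy `‖f‖² = (1/4) ∫ κ² ds`, possibly infinite. -/
def energy (f : Arc) : ENNReal :=
  (1 / 4) * ∫⁻ t in Icc f.a f.b, ENNReal.ofReal (f.curvature t ^ 2 * ‖f.d1 t‖)

/-- A left-curve has nonnegative signed curvature almost everywhere. -/
def IsLeft (f : Arc) : Prop := ∀ᵐ t ∂volume.restrict (Icc f.a f.b), 0 ≤ f.curvature t

/-- A right-curve has nonpositive signed curvature almost everywhere. -/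
def IsRight (f : Arc) : Prop := ∀ᵐ t ∂volume.restrict (Icc f.a f.b), f.curvature t ≤ 0

/-- A left c-curve: a left-curve with turning angle of magnitude at most `π`. -/
def IsLeftC (f : Arc) : Prop := f.IsCurve ∧ f.IsLeft ∧ |f.turning| ≤ Real.pi

/-- A right c-curve: a right-curve with turning angle of magnitude at most `π`. -/
def IsRightC (f : Arc) : Prop := f.IsCurve ∧ f.IsRight ∧ |f.turning| ≤ Real.pi

/-- The sub-curve of `f` over the parameter interval `[c, d]`. -/
def sub (f : Arc) (c d : ℝ) : Arc := ⟨c, d, f.toFun⟩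

/-- An s-curve is a c-curve, or a curve that consists of two c-curves which turn in opposite
directions. -/
def IsSCurve (f : Arc) : Prop :=
  f.IsCurve ∧ (f.IsLeftC ∨ f.IsRightC ∨ ∃ c ∈ Ioo f.a f.b,
    ((f.sub f.a c).IsLeftC ∧ (f.sub c f.b).IsRightC) ∨
    ((f.sub f.a c).IsRightC ∧ (f.sub c f.b).IsLeftC))

/-- The unit tangent vector (position and direction) to `f` at the parameter `t`. -/
def tangent (f : Arc) (t : ℝ) : ℂ × ℂ := (f.toFun t, f.d1 t / ‖f.d1 t‖)

/-- The image of `f` under the orientation preserving similarity `z ↦ c₁ z + c₂`. -/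
def similarityMap (f : Arc) (c₁ c₂ : ℂ) : Arc := ⟨f.a, f.b, fun t => c₁ * f.toFun t + c₂⟩

/-- `g` is directly similar to `f`: it is equivalent to the image of `f` under an orientation
preserving similarity. -/
def DirectlySimilar (g f : Arc) : Prop :=
  ∃ c₁ c₂ : ℂ, c₁ ≠ 0 ∧ g.Equivalent (f.similarityMap c₁ c₂)

/-- `f` has minimal bending energy in the family `S`. -/
def HasMinimalEnergy (S : Set Arc) (f : Arc) : Prop :=
  f ∈ S ∧ ∀ g ∈ S, f.energy ≤ g.energy

end Arc

/-- The set `S(u, v)` of all s-curves that connect the unit tangent vector `u` to the unit tangent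
vector `v`. -/
def sCurves (u v : ℂ × ℂ) : Set Arc :=
  {f | f.IsSCurve ∧ f.tangent f.a = u ∧ f.tangent f.b = v}

/-- `ξ' = sin² / √(1 + sin²)`, `ξ(0) = 0`. -/
def xi (t : ℝ) : ℝ := ∫ r in (0 : ℝ)..t, Real.sin r ^ 2 / √(1 + Real.sin r ^ 2)

/-- Rectangular elastica `E(t) = sin t + i ξ(t)`. -/
def elastica (t : ℝ) : ℂ := (Real.sin t : ℂ) + Complex.I * (xi t : ℂ)

/-- The segment `E_[t₁, t₂]`. -/
def elasticaSegment (t₁ t₂ : ℝ) : Arc := ⟨t₁, t₂, elastica⟩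

/-- `y₁(γ) = (1/2) ∫_0^{α-γ} √(sin τ) dτ`. -/
def y₁ (α γ : ℝ) : ℝ := (1 / 2) * ∫ τ in (0 : ℝ)..(α - γ), √(Real.sin τ)

/-- `y₂(γ) = (1/2) ∫_0^{β-γ} √(sin τ) dτ`. -/
def y₂ (β γ : ℝ) : ℝ := (1 / 2) * ∫ τ in (0 : ℝ)..(β - γ), √(Real.sin τ)

/-- The signed distance `σ(γ)`. -/
def sigma (α β γ : ℝ) : ℝ :=
  Real.cos γ + Real.sin γ / (y₁ α γ + y₂ β γ) *
    (√(Real.sin (α - γ)) + √(Real.sin (β - γ)))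

end ElasticSpline

end

/-! The proof is a calibration argument. Let θ be the direction angle of a curve, s its arclength
and Y = `sqrtSinIntegral`. As long as θ stays in the band [γ, γ + π], completing the square gives
κ²/4 = (κ/2 + c√sin(θ - γ))² - c² sin(θ - γ) - cκ√sin(θ - γ). The last two terms integrate to
quantities fixed by the end data: ∫ sin(θ - γ) ds is the displacement normal to e^{iγ}, and ∫
κ√sin(θ - γ) ds is the increment of Y(θ - γ). So inside the band the energy is the constant
`multiplierEnergy` plus the integral of a square (`integral_bend_eq_multiplierEnergy_add`), and it
is least exactly when κ = -2c√sin(θ - γ).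

Rectangular elastica on [-π, 0] solves this equation with c = 1, γ = 0, so a segment of it, scaled
by 1/c and rotated by γ, solves the general one. It remains to choose (c, γ) so that the segment has
the right chord. These are two real equations, which reduce to one equation in γ, solved by the
intermediate value theorem; σ(β) ≤ 0 supplies one of the two signs (`exists_isMultiplier`).

An s-curve can leave the band only by turning left above γ + π and then right, or right below γ and
then left. For such a curve the square is completed with γ shifted so that the extreme angle lies on
the edge of the band, and with the opposite sign on the left-turning half. The resulting lower bound
is monotone in the shift and strictly exceeds `multiplierEnergy` (`lt_of_turning_above`,
`lt_of_turning_below`).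

For uniqueness, a minimizer stays in the band and its square vanishes almost everywhere. Matching
points of equal direction then exhibits it as a reparametrization of the elastic segment
(`equivalent_elasticArc`). -/

namespace ElasticSpline

/-! ### The integral of √sin and the choice of the multiplier -/

/-- The antiderivative `∫_0^x √(sin τ) dτ`. -/
noncomputable def sqrtSinIntegral (x : ℝ) : ℝ := ∫ τ in (0 : ℝ)..x, √(Real.sin τ)

theorem continuous_sqrt_sin : Continuous fun x => √(Real.sin x) := by fun_prop

theorem hasDerivAt_sqrtSinIntegral (x : ℝ) :
    HasDerivAt sqrtSinIntegral (√(Real.sin x)) x :=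
  intervalIntegral.integral_hasDerivAt_right (continuous_sqrt_sin.intervalIntegrable _ _)
    continuous_sqrt_sin.stronglyMeasurable.stronglyMeasurableAtFilter
    continuous_sqrt_sin.continuousAt

theorem continuous_sqrtSinIntegral : Continuous sqrtSinIntegral :=
  continuous_iff_continuousAt.mpr fun x => (hasDerivAt_sqrtSinIntegral x).continuousAt

@[simp]
theorem sqrtSinIntegral_zero : sqrtSinIntegral 0 = 0 := by simp [sqrtSinIntegral]

theorem monotone_sqrtSinIntegral : Monotone sqrtSinIntegral :=
  monotone_of_deriv_nonneg (fun x => (hasDerivAt_sqrtSinIntegral x).differentiableAt)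
    fun x => by rw [(hasDerivAt_sqrtSinIntegral x).deriv]; positivity

theorem strictMonoOn_sqrtSinIntegral : StrictMonoOn sqrtSinIntegral (Icc 0 Real.pi) := by
  refine strictMonoOn_of_deriv_pos (convex_Icc _ _) continuous_sqrtSinIntegral.continuousOn ?_
  intro x hx
  rw [interior_Icc] at hx
  rw [(hasDerivAt_sqrtSinIntegral x).deriv]
  exact Real.sqrt_pos.mpr (Real.sin_pos_of_mem_Ioo hx)

theorem sqrtSinIntegral_pos {x : ℝ} (h0 : 0 < x) (h1 : x ≤ Real.pi) : 0 < sqrtSinIntegral x := by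
  simpa using strictMonoOn_sqrtSinIntegral ⟨le_rfl, Real.pi_pos.le⟩ ⟨h0.le, h1⟩ h0

theorem sqrt_add_le_sqrt_add_sqrt {x y : ℝ} (hx : 0 ≤ x) (hy : 0 ≤ y) : √(x + y) ≤ √x + √y :=
  Real.sqrt_le_iff.mpr ⟨by positivity, by
    nlinarith [Real.sq_sqrt hx, Real.sq_sqrt hy, mul_nonneg (Real.sqrt_nonneg x) (Real.sqrt_nonneg y)]⟩

/-- The data `(c, γ)` that determine the elastic right c-curve from `(0, e^{iα})` to `(1, e^{iβ})`:
it has curvature `-2c √(sin (θ - γ))` where its direction angle is `θ`. -/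
structure IsMultiplier (α β γ c : ℝ) : Prop where
  α_pos : 0 < α
  β_neg : β < 0
  neg_β_le : -β ≤ α
  lt_γ : α - Real.pi < γ
  γ_le : γ ≤ β
  c_pos : 0 < c
  cos_eq : c * Real.cos γ = √(Real.sin (α - γ)) - √(Real.sin (β - γ))
  sin_eq : c * -Real.sin γ = 1 / 2 * (sqrtSinIntegral (α - γ) - sqrtSinIntegral (β - γ))

/-- The two equations say that the chord C + iS of the unscaled elastica segment equals c e^{-iγ}.
Eliminating c leaves F(γ) = S cos γ + C sin γ = 0, where F(β) has the sign of σ(β) and F is positive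
at α - π whenever F(β) < 0. -/
theorem exists_isMultiplier {α β : ℝ} (hα : α ∈ Ioo 0 Real.pi) (hβ : β < 0) (hβα : |β| ≤ α)
    (hαβ : α - Real.pi < β) (hσ : sigma α β β ≤ 0) : ∃ γ c, IsMultiplier α β γ c := by
  have hβα' : -β ≤ α := (neg_le_abs β).trans hβα
  set F : ℝ → ℝ := fun γ => Real.cos γ * (1 / 2 * (sqrtSinIntegral (α - γ) - sqrtSinIntegral (β - γ)))
    + Real.sin γ * (√(Real.sin (α - γ)) - √(Real.sin (β - γ))) with hF
  have hFc : Continuous F := by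
    have := continuous_sqrtSinIntegral
    fun_prop
  set Y := sqrtSinIntegral (α - β) with hY
  set s := √(Real.sin (α - β)) with hs
  have hYpos : 0 < Y := sqrtSinIntegral_pos (by linarith) (by linarith)
  have hspos : 0 < s := Real.sqrt_pos.mpr (Real.sin_pos_of_pos_of_lt_pi (by linarith) (by linarith))
  have hFβ : F β = Real.cos β * (1 / 2 * Y) + Real.sin β * s := by simp [hF, hY, hs]
  have hFβ0 : F β ≤ 0 := by
    have h1 : sigma α β β = Real.cos β + Real.sin β / (1 / 2 * Y) * s := by
      simp [sigma, y₁, y₂, hY, hs, sqrtSinIntegral]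
    rw [h1] at hσ
    have h2 : F β = (Real.cos β + Real.sin β / (1 / 2 * Y) * s) * (1 / 2 * Y) := by
      rw [hFβ]; field_simp
    rw [h2]
    exact mul_nonpos_of_nonpos_of_nonneg hσ (by positivity)
  -- The symmetry of sin about π/2 makes the integral over the last α - β units of [0, π] equal to
  -- the one over the first.
  have hP : sqrtSinIntegral Real.pi - sqrtSinIntegral (β - (α - Real.pi)) = Y := by
    have h := intervalIntegral.integral_comp_sub_left (a := 0) (b := α - β)
      (fun x => √(Real.sin x)) Real.pi
    simp only [Real.sin_pi_sub, sub_zero] at h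
    rw [hY, show sqrtSinIntegral (α - β) = _ from h, sub_eq_iff_eq_add, add_comm,
      show β - (α - Real.pi) = Real.pi - (α - β) by ring]
    exact (intervalIntegral.integral_add_adjacent_intervals
      (continuous_sqrt_sin.intervalIntegrable _ _)
      (continuous_sqrt_sin.intervalIntegrable _ _)).symm
  have hFα : F (α - Real.pi) = -Real.cos α * (1 / 2 * Y) + Real.sin α * s := by
    have e1 : α - (α - Real.pi) = Real.pi := by ring
    have e2 : Real.sin (β - (α - Real.pi)) = Real.sin (α - β) := by
      rw [show β - (α - Real.pi) = Real.pi - (α - β) by ring, Real.sin_pi_sub]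
    simp only [hF, e1, hP, e2, Real.sin_pi, Real.sqrt_zero, Real.cos_sub_pi, Real.sin_sub_pi]
    rw [← hs]; ring
  have hsinα : 0 < Real.sin α := Real.sin_pos_of_mem_Ioo hα
  have hcosβ : 0 < Real.cos β := Real.cos_pos_of_mem_Ioo ⟨by linarith, by linarith [Real.pi_pos]⟩
  obtain ⟨γ, hγ1, hγ2, hγ⟩ : ∃ γ, α - Real.pi < γ ∧ γ ≤ β ∧ F γ = 0 := by
    rcases hFβ0.eq_or_lt with h | h
    · exact ⟨β, hαβ, le_rfl, h⟩
    have hpos : 0 < F (α - Real.pi) := by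
      rw [hFα]
      rcases le_or_gt (Real.pi / 2) α with h2 | h2
      · have : Real.cos α ≤ 0 := Real.cos_nonpos_of_pi_div_two_le_of_le h2 (by linarith [hα.2])
        nlinarith [mul_pos hsinα hspos]
      -- Here F(β) < 0 is itself used: cos α · Y/2 ≤ cos β · Y/2 < sin(-β) · s ≤ sin α · s, by -β ≤
      -- α < π/2.
      · have hcα : 0 < Real.cos α := Real.cos_pos_of_mem_Ioo ⟨by linarith [hα.1], h2⟩
        have h3 : Real.sin β = -Real.sin (-β) := by simp
        have h4 : Real.cos β = Real.cos (-β) := by simp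
        have h5 : Real.sin (-β) ≤ Real.sin α :=
          Real.sin_le_sin_of_le_of_le_pi_div_two (by linarith) h2.le hβα'
        have h6 : Real.cos α ≤ Real.cos (-β) :=
          Real.cos_le_cos_of_nonneg_of_le_pi (by linarith) hα.2.le hβα'
        rw [hFβ, h3, h4] at h
        nlinarith
    obtain ⟨γ, hγ, h0⟩ := intermediate_value_Ioo' hαβ.le hFc.continuousOn ⟨h, hpos⟩
    exact ⟨γ, hγ.1, hγ.2.le, h0⟩
  have hsγ : 0 < -Real.sin γ := by
    rw [← Real.sin_neg]
    exact Real.sin_pos_of_pos_of_lt_pi (by linarith) (by linarith [hα.1])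
  have hd : 0 < sqrtSinIntegral (α - γ) - sqrtSinIntegral (β - γ) :=
    sub_pos.mpr (strictMonoOn_sqrtSinIntegral ⟨by linarith, by linarith [hα.2]⟩
      ⟨by linarith, by linarith⟩ (by linarith))
  -- The value of c is read off from the sine equation, as sin γ < 0; the cosine equation is then
  -- F(γ) = 0.
  refine ⟨γ, 1 / 2 * (sqrtSinIntegral (α - γ) - sqrtSinIntegral (β - γ)) / -Real.sin γ,
    hα.1, hβ, hβα', hγ1, hγ2, by positivity, ?_, ?_⟩
  · rw [div_mul_eq_mul_div, div_eq_iff hsγ.ne']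
    simp only [hF] at hγ
    linarith
  · exact div_mul_cancel₀ _ hsγ.ne'

/-! ### Monotonicity of the lower bounds outside the band -/

namespace IsMultiplier

variable {α β γ c : ℝ} (h : IsMultiplier α β γ c)
include h

theorem β_gt : -(Real.pi / 2) < β := by linarith [h.neg_β_le, h.lt_γ, h.γ_le]

/-- The pointwise bound behind the comparison with curves that turn below the angle `γ`. -/
theorem mul_cos_lt {x : ℝ} (hx1 : α - Real.pi < x) (hx2 : x < γ) :
    c * Real.cos x < √(Real.sin (α - x)) + √(Real.sin (β - x)) := by
  obtain ⟨h1, h2, h3, h4, h5, h6, h7, -⟩ := h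
  have hpi := Real.pi_pos
  have hsα : 0 < √(Real.sin (α - x)) :=
    Real.sqrt_pos.mpr (Real.sin_pos_of_pos_of_lt_pi (by linarith) (by linarith))
  have hsβ : 0 < √(Real.sin (β - x)) :=
    Real.sqrt_pos.mpr (Real.sin_pos_of_pos_of_lt_pi (by linarith) (by linarith))
  rcases le_or_gt (Real.cos x) 0 with hc | hc
  · nlinarith
  have hcos : Real.cos x < Real.cos γ := by
    rw [← Real.cos_neg x, ← Real.cos_neg γ]
    exact Real.cos_lt_cos_of_nonneg_of_le_pi (by linarith) (by linarith) (by linarith)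
  have hle : c * Real.cos γ ≤ √(Real.sin (α - γ)) := by
    rw [h7]; linarith [Real.sqrt_nonneg (Real.sin (β - γ))]
  -- For α ≥ π/2, sin(α - γ) ≤ sin(α - β), and subadditivity of sin on [0, π] and of the square root
  -- bounds this by the right side.
  rcases le_or_gt (Real.pi / 2) α with h2α | h2α
  · have hw : Real.sin (α - γ) ≤ Real.sin (α - β) := by
      rw [← Real.sin_pi_sub (α - γ), ← Real.sin_pi_sub (α - β)]
      exact Real.sin_le_sin_of_le_of_le_pi_div_two (by linarith) (by linarith) (by linarith)
    have hA : 0 ≤ Real.sin (Real.pi - (α - x)) := Real.sin_nonneg_of_nonneg_of_le_pi (by linarith)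
      (by linarith)
    have hB : 0 ≤ Real.sin (β - x) := Real.sin_nonneg_of_nonneg_of_le_pi (by linarith)
      (by linarith)
    have hadd : Real.sin (α - β) ≤ Real.sin (α - x) + Real.sin (β - x) := by
      rw [← Real.sin_pi_sub (α - β), ← Real.sin_pi_sub (α - x),
        show Real.pi - (α - β) = (Real.pi - (α - x)) + (β - x) by ring, Real.sin_add]
      nlinarith [Real.cos_le_one (β - x), Real.cos_le_one (Real.pi - (α - x))]
    have hsq : √(Real.sin (α - γ)) ≤ √(Real.sin (α - x)) + √(Real.sin (β - x)) :=
      (Real.sqrt_le_sqrt (hw.trans hadd)).trans (sqrt_add_le_sqrt_add_sqrt (Real.sqrt_pos.mp hsα).le hB)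
    nlinarith
  · have hcα : 0 < Real.cos α := Real.cos_pos_of_mem_Ioo ⟨by linarith, h2α⟩
    have hsγ : 0 ≤ Real.sin (α - γ) := Real.sin_nonneg_of_nonneg_of_le_pi (by linarith)
      (by linarith)
    -- The quotient sin(α - x)/cos x = sin α - cos α tan x decreases in x because cos α > 0. One
    -- more use of cos x < cos γ gives the squared form of `key2`.
    have key : Real.sin (α - γ) * Real.cos x ≤ Real.sin (α - x) * Real.cos γ := by
      have : Real.sin (α - x) * Real.cos γ - Real.sin (α - γ) * Real.cos x
          = Real.cos α * Real.sin (γ - x) := by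
        simp only [Real.sin_sub]; ring
      have h0 : 0 ≤ Real.sin (γ - x) := Real.sin_nonneg_of_nonneg_of_le_pi (by linarith)
        (by linarith)
      nlinarith
    have key2 : √(Real.sin (α - γ)) * Real.cos x ≤ √(Real.sin (α - x)) * Real.cos γ := by
      refine le_of_sq_le_sq ?_ (by nlinarith)
      rw [mul_pow, mul_pow, Real.sq_sqrt hsγ, Real.sq_sqrt (Real.sqrt_pos.mp hsα).le]
      nlinarith [mul_nonneg hsγ hc.le]
    have : c * Real.cos x * Real.cos γ ≤ √(Real.sin (α - x)) * Real.cos γ := by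
      nlinarith
    have := le_of_mul_le_mul_right this (by linarith)
    linarith

/-- The pointwise bound behind the comparison with curves that turn above the angle `γ + π`. -/
theorem neg_mul_cos_lt {x : ℝ} (hx1 : γ < x) (hx2 : x < β) :
    -(c * Real.cos x) < √(Real.sin (α - x)) + √(Real.sin (β - x)) := by
  have hβ2 := h.β_gt
  obtain ⟨h1, h2, h3, h4, h5, h6, h7, -⟩ := h
  have hpi := Real.pi_pos
  have hsα : 0 < √(Real.sin (α - x)) :=
    Real.sqrt_pos.mpr (Real.sin_pos_of_pos_of_lt_pi (by linarith) (by linarith))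
  have hsβ : 0 < √(Real.sin (β - x)) :=
    Real.sqrt_pos.mpr (Real.sin_pos_of_pos_of_lt_pi (by linarith) (by linarith))
  rcases le_or_gt 0 (Real.cos x) with hc | hc
  · nlinarith
  have hcos : Real.cos γ < Real.cos x := by
    rw [← Real.cos_neg x, ← Real.cos_neg γ]
    exact Real.cos_lt_cos_of_nonneg_of_le_pi (by linarith) (by linarith) (by linarith)
  have hle : -(c * Real.cos γ) ≤ √(Real.sin (β - γ)) := by
    rw [h7]; linarith [Real.sqrt_nonneg (Real.sin (α - γ))]
  have hcβ : 0 < Real.cos β := Real.cos_pos_of_mem_Ioo ⟨by linarith, by linarith⟩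
  have hsγ : 0 ≤ Real.sin (β - γ) := Real.sin_nonneg_of_nonneg_of_le_pi (by linarith)
    (by linarith)
  have key : Real.sin (β - γ) * -Real.cos x ≤ Real.sin (β - x) * -Real.cos γ := by
    have : Real.sin (β - x) * -Real.cos γ - Real.sin (β - γ) * -Real.cos x
        = Real.cos β * Real.sin (x - γ) := by
      simp only [Real.sin_sub]; ring
    have h0 : 0 ≤ Real.sin (x - γ) := Real.sin_nonneg_of_nonneg_of_le_pi (by linarith)
      (by linarith)
    nlinarith
  have key2 : √(Real.sin (β - γ)) * -Real.cos x ≤ √(Real.sin (β - x)) * -Real.cos γ := by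
    refine le_of_sq_le_sq ?_ (by nlinarith)
    rw [mul_pow, mul_pow, Real.sq_sqrt hsγ, Real.sq_sqrt (Real.sqrt_pos.mp hsβ).le]
    nlinarith [mul_nonneg hsγ (neg_nonneg.mpr hc.le)]
  have : -(c * Real.cos x) * -Real.cos γ ≤ √(Real.sin (β - x)) * -Real.cos γ := by
    nlinarith
  have := le_of_mul_le_mul_right this (by linarith)
  linarith

/-- Multiplied by c, the right side plays the role of the energy bound for a curve that turns right
down to γ' < γ and then left, and the left side that of `multiplierEnergy`, after c² sin is split
off. The right side decreases in γ' by `mul_cos_lt`, and at γ it exceeds the left side by 2Y(β - γ)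
≥ 0. -/
theorem lt_of_turning_below {γ' : ℝ} (h1 : α - Real.pi ≤ γ') (h2 : γ' < γ) :
    sqrtSinIntegral (α - γ) - sqrtSinIntegral (β - γ) + c * Real.sin γ <
      sqrtSinIntegral (α - γ') + sqrtSinIntegral (β - γ') + c * Real.sin γ' := by
  set D : ℝ → ℝ := fun x => sqrtSinIntegral (α - x) + sqrtSinIntegral (β - x) + c * Real.sin x
  have hD : ∀ x, HasDerivAt D
      (-√(Real.sin (α - x)) + -√(Real.sin (β - x)) + c * Real.cos x) x := by
    intro x
    have e : ∀ y : ℝ, HasDerivAt (fun x => sqrtSinIntegral (y - x)) (-√(Real.sin (y - x))) x := by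
      intro y
      simpa using HasDerivAt.comp_const_sub y x (hasDerivAt_sqrtSinIntegral (y - x))
    exact ((e α).add (e β)).add ((Real.hasDerivAt_sin x).const_mul c)
  have hanti : StrictAntiOn D (Icc (α - Real.pi) γ) := by
    refine strictAntiOn_of_deriv_neg (convex_Icc _ _)
      (fun x _ => (hD x).continuousAt.continuousWithinAt) fun x hx => ?_
    rw [interior_Icc] at hx
    rw [(hD x).deriv]
    linarith [h.mul_cos_lt hx.1 hx.2]
  have h3 : D γ < D γ' := hanti ⟨h1, h2.le⟩ ⟨h.lt_γ.le, le_rfl⟩ h2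
  have h4 : 0 ≤ sqrtSinIntegral (β - γ) := by
    simpa using monotone_sqrtSinIntegral (sub_nonneg.mpr h.γ_le)
  simp only [D] at h3
  linarith

/-- The counterpart for curves that turn left up to γ' + π and then right: the bound increases in γ'
by `neg_mul_cos_lt`, and at γ it exceeds the left side by 2(Y(π) - Y(α - γ)) ≥ 0. -/
theorem lt_of_turning_above {γ' : ℝ} (h1 : γ < γ') (h2 : γ' ≤ β) :
    sqrtSinIntegral (α - γ) - sqrtSinIntegral (β - γ) + c * Real.sin γ <
      2 * sqrtSinIntegral Real.pi - sqrtSinIntegral (α - γ') - sqrtSinIntegral (β - γ')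
        + c * Real.sin γ' := by
  set D : ℝ → ℝ := fun x => 2 * sqrtSinIntegral Real.pi - sqrtSinIntegral (α - x)
    - sqrtSinIntegral (β - x) + c * Real.sin x
  have hD : ∀ x, HasDerivAt D
      (0 - -√(Real.sin (α - x)) - -√(Real.sin (β - x)) + c * Real.cos x) x := by
    intro x
    have e : ∀ y : ℝ, HasDerivAt (fun x => sqrtSinIntegral (y - x)) (-√(Real.sin (y - x))) x := by
      intro y
      simpa using HasDerivAt.comp_const_sub y x (hasDerivAt_sqrtSinIntegral (y - x))
    exact (((hasDerivAt_const x _).sub (e α)).sub (e β)).add ((Real.hasDerivAt_sin x).const_mul c)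
  have hmono : StrictMonoOn D (Icc γ β) := by
    refine strictMonoOn_of_deriv_pos (convex_Icc _ _)
      (fun x _ => (hD x).continuousAt.continuousWithinAt) fun x hx => ?_
    rw [interior_Icc] at hx
    rw [(hD x).deriv]
    linarith [h.neg_mul_cos_lt hx.1 hx.2]
  have h3 : D γ < D γ' := hmono ⟨le_rfl, h.γ_le⟩ ⟨h1.le, h2⟩ h1
  have h4 : sqrtSinIntegral (α - γ) ≤ sqrtSinIntegral Real.pi :=
    monotone_sqrtSinIntegral (by linarith [h.lt_γ])
  simp only [D] at h3
  linarith

end IsMultiplier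

end ElasticSpline

/-! ### Absolutely continuous functions with complex values -/

/-- An absolutely continuous function is bounded, and a C¹ map is Lipschitz on the compact convex
ball containing its values. -/
theorem AbsolutelyContinuousOnInterval.contDiff_comp {E F : Type*}
    [NormedAddCommGroup E] [NormedSpace ℝ E] [ProperSpace E] [NormedAddCommGroup F]
    [NormedSpace ℝ F] {f : ℝ → E} {a b : ℝ} {J : E → F} (hJ : ContDiff ℝ 1 J)
    (hf : AbsolutelyContinuousOnInterval f a b) :
    AbsolutelyContinuousOnInterval (fun t => J (f t)) a b := by
  obtain ⟨C, hC⟩ := hf.exists_bound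
  obtain ⟨K, hK⟩ := (hJ.contDiffOn (s := Metric.closedBall 0 C)).exists_lipschitzOnWith one_ne_zero
    (convex_closedBall _ _) (isCompact_closedBall _ _)
  have hlim := Filter.Tendsto.const_mul (K : ℝ) hf
  rw [mul_zero] at hlim
  refine squeeze_zero' (Filter.Eventually.of_forall fun E => Finset.sum_nonneg fun _ _ => dist_nonneg)
    ?_ hlim
  filter_upwards [Filter.mem_inf_of_right (Filter.mem_principal_self _)] with E hE
  rw [Finset.mul_sum]
  refine Finset.sum_le_sum fun i hi => hK.dist_le_mul _ ?_ _ ?_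
  · simpa using hC _ (hE.1 i hi).1
  · simpa using hC _ (hE.1 i hi).2

theorem AbsolutelyContinuousOnInterval.intervalIntegrable_deriv_complex {f : ℝ → ℂ} {a b : ℝ}
    (hf : AbsolutelyContinuousOnInterval f a b) : IntervalIntegrable (deriv f) volume a b := by
  have hre := (hf.contDiff_comp Complex.reCLM.contDiff).intervalIntegrable_deriv
  have him := (hf.contDiff_comp Complex.imCLM.contDiff).intervalIntegrable_deriv
  have hre' : IntervalIntegrable (fun t => ((deriv (fun t => Complex.reCLM (f t)) t : ℝ) : ℂ))
    volume a b := ⟨hre.1.ofReal, hre.2.ofReal⟩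
  have him' : IntervalIntegrable (fun t => ((deriv (fun t => Complex.imCLM (f t)) t : ℝ) : ℂ))
    volume a b := ⟨him.1.ofReal, him.2.ofReal⟩
  have h := hre'.add (him'.mul_const Complex.I)
  refine h.congr_ae ?_
  rw [Filter.EventuallyEq, ae_restrict_iff' measurableSet_uIoc]
  filter_upwards [hf.boundedVariationOn.ae_differentiableAt_of_mem_uIcc] with t ht ht'
  have hd := (ht (uIoc_subset_uIcc ht')).hasDerivAt
  have h1 := (Complex.reCLM.hasFDerivAt.comp_hasDerivAt t hd).deriv
  have h2 := (Complex.imCLM.hasFDerivAt.comp_hasDerivAt t hd).deriv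
  simp only [Function.comp_def, Complex.reCLM_apply, Complex.imCLM_apply] at h1 h2
  simp [h1, h2]

theorem IntervalIntegrable.absolutelyContinuousOnInterval_intervalIntegral_complex {f : ℝ → ℂ}
    {a b : ℝ} (hf : IntervalIntegrable f volume a b) :
    AbsolutelyContinuousOnInterval (fun x => ∫ t in a..x, f t) a b := by
  have hre : IntervalIntegrable (fun t => (f t).re) volume a b := ⟨hf.1.re, hf.2.re⟩
  have him : IntervalIntegrable (fun t => (f t).im) volume a b := ⟨hf.1.im, hf.2.im⟩
  have h1 := (hre.absolutelyContinuousOnInterval_intervalIntegral left_mem_uIcc).contDiff_comp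
    Complex.ofRealCLM.contDiff
  have h2 := ((him.absolutelyContinuousOnInterval_intervalIntegral
    left_mem_uIcc).contDiff_comp Complex.ofRealCLM.contDiff).const_smul Complex.I
  have h3 := h1.fun_add h2
  refine Filter.Tendsto.congr' ?_ h3
  filter_upwards [Filter.mem_inf_of_right (Filter.mem_principal_self _)] with E hE
  have key : ∀ x ∈ uIcc a b, Complex.ofRealCLM (∫ t in a..x, (f t).re)
      + Complex.I • Complex.ofRealCLM (∫ t in a..x, (f t).im) = ∫ t in a..x, f t := by
    intro x hx
    have hfx : IntervalIntegrable f volume a x := hf.mono_set (uIcc_subset_uIcc_left hx)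
    have e1 := Complex.reCLM.intervalIntegral_comp_comm hfx
    have e2 := Complex.imCLM.intervalIntegral_comp_comm hfx
    simp only [Complex.reCLM_apply, Complex.imCLM_apply] at e1 e2
    rw [e1, e2]
    simp only [Complex.ofRealCLM_apply, smul_eq_mul]
    rw [mul_comm]
    exact Complex.re_add_im _
  refine Finset.sum_congr rfl fun i hi => ?_
  rw [key _ (hE.1 i hi).1, key _ (hE.1 i hi).2]

/-! ### The direction angle of a curve -/

namespace ElasticSpline
namespace Arc

/-- The rate `κ |f'|` at which the direction of `f` turns. -/
noncomputable def turnRate (f : Arc) (t : ℝ) : ℝ := f.curvature t * ‖f.d1 t‖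

/-- The direction angle of `f`, normalized to be `α` at the initial point. -/
noncomputable def angle (f : Arc) (α t : ℝ) : ℝ := α + ∫ r in f.a..t, f.turnRate r

theorem turnRate_eq (f : Arc) (t : ℝ) : f.turnRate t = (f.d2 t / f.d1 t).im := by
  rcases eq_or_ne (f.d1 t) 0 with h | h
  · simp [turnRate, h]
  have hn : ‖f.d1 t‖ ≠ 0 := norm_ne_zero_iff.mpr h
  have h2 : f.d2 t / f.d1 t
      = ((starRingEnd ℂ) (f.d1 t) * f.d2 t) * (((‖f.d1 t‖ ^ 2)⁻¹ : ℝ) : ℂ) := by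
    rw [div_eq_mul_inv, Complex.inv_def, Complex.normSq_eq_norm_sq]
    ring
  rw [h2, Complex.im_mul_ofReal, turnRate, curvature]
  field_simp

@[simp]
theorem angle_left (f : Arc) (α : ℝ) : f.angle α f.a = α := by simp [angle]

namespace IsCurve

variable {f : Arc}

theorem continuousOn_d1 (hf : f.IsCurve) : ContinuousOn f.d1 (Icc f.a f.b) := by
  simpa [uIcc_of_le hf.lt.le] using hf.absolutelyContinuous.continuousOn

theorem hasDerivWithinAt (hf : f.IsCurve) {t : ℝ} (ht : t ∈ Icc f.a f.b) :
    HasDerivWithinAt f.toFun (f.d1 t) (Icc f.a f.b) t :=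
  (hf.differentiableOn t ht).hasDerivWithinAt

theorem ae_hasDerivAt_d1 (hf : f.IsCurve) :
    ∀ᵐ t, t ∈ Icc f.a f.b → HasDerivAt f.d1 (f.d2 t) t := by
  filter_upwards [hf.absolutelyContinuous.boundedVariationOn.ae_differentiableAt_of_mem_uIcc]
    with t ht ht'
  have hd := ht (by rwa [uIcc_of_le hf.lt.le])
  rw [d2, hd.derivWithin (uniqueDiffOn_Icc hf.lt t ht')]
  exact hd.hasDerivAt

theorem intervalIntegrable_d2 (hf : f.IsCurve) : IntervalIntegrable f.d2 volume f.a f.b := by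
  refine hf.absolutelyContinuous.intervalIntegrable_deriv_complex.congr_ae ?_
  rw [Filter.EventuallyEq, ae_restrict_iff' measurableSet_uIoc]
  filter_upwards [hf.ae_hasDerivAt_d1] with t ht ht'
  rw [uIoc_of_le hf.lt.le] at ht'
  exact (ht (Ioc_subset_Icc_self ht')).deriv

theorem intervalIntegrable_d2_div_d1 (hf : f.IsCurve) :
    IntervalIntegrable (fun t => f.d2 t / f.d1 t) volume f.a f.b := by
  simp only [div_eq_mul_inv]
  refine hf.intervalIntegrable_d2.mul_continuousOn ?_
  rw [uIcc_of_le hf.lt.le]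
  exact hf.continuousOn_d1.inv₀ hf.d1_ne_zero

theorem intervalIntegrable_turnRate (hf : f.IsCurve) :
    IntervalIntegrable f.turnRate volume f.a f.b := by
  have h := hf.intervalIntegrable_d2_div_d1
  have h' : IntervalIntegrable (fun t => (f.d2 t / f.d1 t).im) volume f.a f.b := ⟨h.1.im, h.2.im⟩
  exact h'.congr fun t _ => (f.turnRate_eq t).symm

/-- With Λ the integral of f''/f', the product f' e^{-Λ} is absolutely continuous with derivative
zero almost everywhere, hence constant. The imaginary part of Λ is the continuous choice of
direction angle. -/
theorem d1_eq_mul_exp (hf : f.IsCurve) {t : ℝ} (ht : t ∈ Icc f.a f.b) :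
    f.d1 t = f.d1 f.a * Complex.exp (∫ r in f.a..t, f.d2 r / f.d1 r) := by
  set Λ : ℝ → ℂ := fun t => ∫ r in f.a..t, f.d2 r / f.d1 r with hΛ
  have hint := hf.intervalIntegrable_d2_div_d1
  have hac : AbsolutelyContinuousOnInterval (fun t => f.d1 t * Complex.exp (-Λ t)) f.a f.b :=
    hf.absolutelyContinuous.fun_smul
      (hint.absolutelyContinuousOnInterval_intervalIntegral_complex.contDiff_comp
        (J := fun z => Complex.exp (-z)) (by fun_prop))
  have hder : ∀ᵐ t, t ∈ uIcc f.a f.b → HasDerivAt (fun t => f.d1 t * Complex.exp (-Λ t)) 0 t := by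
    filter_upwards [hf.ae_hasDerivAt_d1, hint.ae_hasDerivAt_integral] with t h1 h2 h3
    have h4 := h2 h3 f.a left_mem_uIcc
    rw [uIcc_of_le hf.lt.le] at h3
    have h5 : HasDerivAt (fun t => f.d1 t * Complex.exp (-Λ t))
      (f.d2 t * Complex.exp (-Λ t) + f.d1 t * (Complex.exp (-Λ t) * -(f.d2 t / f.d1 t))) t :=
      (h1 h3).mul h4.neg.cexp
    refine h5.congr_deriv ?_
    have := hf.d1_ne_zero t h3
    field_simp
    ring
  obtain ⟨C, hC⟩ := hac.const_of_ae_hasDerivAt_zero hder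
  rw [uIcc_of_le hf.lt.le] at hC
  have h1 := hC t ht
  have h2 := hC f.a (left_mem_Icc.mpr hf.lt.le)
  rw [← h2] at h1
  have h3 : f.d1 t = f.d1 t * Complex.exp (-Λ t) * Complex.exp (Λ t) := by
    rw [mul_assoc, ← Complex.exp_add]; simp
  rw [h3, h1]
  simp [hΛ]

theorem d1_eq_norm_mul_exp_angle (hf : f.IsCurve) {α : ℝ}
    (hα : f.d1 f.a / ‖f.d1 f.a‖ = Complex.exp (α * Complex.I)) {t : ℝ} (ht : t ∈ Icc f.a f.b) :
    f.d1 t = ‖f.d1 t‖ * Complex.exp (f.angle α t * Complex.I) := by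
  set Λ : ℂ := ∫ r in f.a..t, f.d2 r / f.d1 r with hΛ
  have h1 : f.d1 t = f.d1 f.a * Complex.exp Λ := hf.d1_eq_mul_exp ht
  have hn : (‖f.d1 f.a‖ : ℂ) ≠ 0 := by
    simpa using hf.d1_ne_zero f.a (left_mem_Icc.mpr hf.lt.le)
  have h2 : f.d1 f.a = ‖f.d1 f.a‖ * Complex.exp (α * Complex.I) := by
    rw [← hα]; field_simp
  have h3 : f.angle α t = α + Λ.im := by
    have hint : IntervalIntegrable (fun r => f.d2 r / f.d1 r) volume f.a t :=
      hf.intervalIntegrable_d2_div_d1.mono_set (by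
        rw [uIcc_of_le hf.lt.le, uIcc_of_le ht.1]; exact Icc_subset_Icc_right ht.2)
    have := Complex.imCLM.intervalIntegral_comp_comm hint
    simp only [Complex.imCLM_apply] at this
    rw [angle, hΛ, ← this]
    simp only [turnRate_eq]
  have h4 : ‖f.d1 t‖ = ‖f.d1 f.a‖ * Real.exp Λ.re := by
    rw [h1, norm_mul, Complex.norm_exp]
  rw [h4, h3, h1]
  nth_rw 1 [h2]
  rw [Complex.ofReal_mul, Complex.ofReal_exp, mul_assoc, mul_assoc, ← Complex.exp_add,
    ← Complex.exp_add]
  congr 2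
  nth_rw 1 [← Complex.re_add_im Λ]
  push_cast
  ring

theorem intervalIntegrable_turnRate_of_mem (hf : f.IsCurve) {p q : ℝ} (hp : p ∈ Icc f.a f.b)
    (hq : q ∈ Icc f.a f.b) : IntervalIntegrable f.turnRate volume p q :=
  hf.intervalIntegrable_turnRate.mono_set (by
    rw [← uIcc_of_le hf.lt.le] at hp hq; exact uIcc_subset_uIcc hp hq)

theorem angle_sub (hf : f.IsCurve) (α : ℝ) {p q : ℝ} (hp : p ∈ Icc f.a f.b)
    (hq : q ∈ Icc f.a f.b) : f.angle α q - f.angle α p = ∫ t in p..q, f.turnRate t := by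
  have ha := left_mem_Icc.mpr hf.lt.le
  rw [angle, angle, add_sub_add_left_eq_sub]
  exact intervalIntegral.integral_interval_sub_left (hf.intervalIntegrable_turnRate_of_mem ha hq)
    (hf.intervalIntegrable_turnRate_of_mem ha hp)

theorem absolutelyContinuous_angle (hf : f.IsCurve) (α : ℝ) :
    AbsolutelyContinuousOnInterval (f.angle α) f.a f.b :=
  (hf.intervalIntegrable_turnRate.absolutelyContinuousOnInterval_intervalIntegral
    left_mem_uIcc).contDiff_comp (J := fun x => α + x) (by fun_prop)

theorem continuousOn_angle (hf : f.IsCurve) (α : ℝ) : ContinuousOn (f.angle α) (Icc f.a f.b) := by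
  simpa [uIcc_of_le hf.lt.le] using (hf.absolutelyContinuous_angle α).continuousOn

theorem ae_hasDerivAt_angle (hf : f.IsCurve) (α : ℝ) :
    ∀ᵐ t, t ∈ Icc f.a f.b → HasDerivAt (f.angle α) (f.turnRate t) t := by
  filter_upwards [hf.intervalIntegrable_turnRate.ae_hasDerivAt_integral] with t h1 h2
  rw [← uIcc_of_le hf.lt.le] at h2
  exact (h1 h2 f.a left_mem_uIcc).const_add α

end IsCurve
end Arc
end ElasticSpline

/-! ### Completing the square in the bending energy -/

namespace ElasticSpline

theorem contDiff_sqrtSinIntegral : ContDiff ℝ 1 sqrtSinIntegral := by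
  rw [contDiff_one_iff_deriv]
  refine ⟨fun x => (hasDerivAt_sqrtSinIntegral x).differentiableAt, ?_⟩
  have : deriv sqrtSinIntegral = fun x => √(Real.sin x) :=
    funext fun x => (hasDerivAt_sqrtSinIntegral x).deriv
  rw [this]
  exact continuous_sqrt_sin

namespace Arc

/-- The integrand `κ² |f'|` of the bending energy. -/
noncomputable def bend (f : Arc) (t : ℝ) : ℝ := f.curvature t ^ 2 * ‖f.d1 t‖

theorem bend_nonneg (f : Arc) (t : ℝ) : 0 ≤ f.bend t := by unfold bend; positivity

/-- The component of `z` in the direction `i e^{iγ}`. -/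
noncomputable def height (γ : ℝ) (z : ℂ) : ℝ := (Complex.exp (-(γ * Complex.I)) * z).im

theorem height_mul_exp (γ r θ : ℝ) :
    height γ (r * Complex.exp (θ * Complex.I)) = r * Real.sin (θ - γ) := by
  rw [height, mul_left_comm, ← Complex.exp_add,
    show -((γ : ℂ) * Complex.I) + θ * Complex.I = ((θ - γ : ℝ) : ℂ) * Complex.I by push_cast; ring,
    Complex.im_ofReal_mul, Complex.exp_ofReal_mul_I_im]

theorem height_one (γ : ℝ) : height γ 1 = -Real.sin γ := by
  have := height_mul_exp γ 1 0
  simpa using this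

theorem height_zero (γ : ℝ) : height γ 0 = 0 := by simp [height]

namespace IsCurve

variable {f : Arc}

theorem aestronglyMeasurable_bend (hf : f.IsCurve) :
    AEStronglyMeasurable f.bend (volume.restrict (Icc f.a f.b)) := by
  have h1 : AEStronglyMeasurable f.turnRate (volume.restrict (Icc f.a f.b)) := by
    rw [← restrict_Ioc_eq_restrict_Icc]
    exact hf.intervalIntegrable_turnRate.1.aestronglyMeasurable
  have h2 : AEStronglyMeasurable (fun t => ‖f.d1 t‖⁻¹) (volume.restrict (Icc f.a f.b)) :=
    (hf.continuousOn_d1.norm.inv₀ fun t ht =>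
      norm_ne_zero_iff.mpr (hf.d1_ne_zero t ht)).aestronglyMeasurable measurableSet_Icc
  refine ((h1.pow 2).mul h2).congr ?_
  rw [Filter.EventuallyEq, ae_restrict_iff' measurableSet_Icc]
  refine Filter.Eventually.of_forall fun t ht => ?_
  have := norm_ne_zero_iff.mpr (hf.d1_ne_zero t ht)
  simp only [Pi.mul_apply, Pi.pow_apply, turnRate, bend]
  field_simp

theorem integrableOn_bend (hf : f.IsCurve) (h : f.energy ≠ ⊤) :
    IntegrableOn f.bend (Icc f.a f.b) := by
  refine ⟨hf.aestronglyMeasurable_bend, ?_⟩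
  rw [hasFiniteIntegral_iff_ofReal (Filter.Eventually.of_forall f.bend_nonneg), lt_top_iff_ne_top]
  intro h'
  apply h
  unfold energy
  change 1 / 4 * ∫⁻ t in Icc f.a f.b, ENNReal.ofReal (f.bend t) = ⊤
  rw [h']
  exact ENNReal.mul_top (by simp)

theorem energy_eq (hf : f.IsCurve) (h : IntegrableOn f.bend (Icc f.a f.b)) :
    f.energy = ENNReal.ofReal (1 / 4 * ∫ t in f.a..f.b, f.bend t) := by
  rw [ENNReal.ofReal_mul (by norm_num), intervalIntegral.integral_of_le hf.lt.le,
    ← integral_Icc_eq_integral_Ioc,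
    ofReal_integral_eq_lintegral_ofReal h (Filter.Eventually.of_forall f.bend_nonneg), energy]
  congr 1
  rw [ENNReal.ofReal_div_of_pos (by norm_num)]
  simp

/-- The integrand is the component of f' along i e^{iγ}, so the integral depends on the end points
only. -/
theorem integral_norm_mul_sin (hf : f.IsCurve) {α : ℝ}
    (hα : f.d1 f.a / ‖f.d1 f.a‖ = Complex.exp (α * Complex.I)) (γ : ℝ) {p q : ℝ} (hpq : p ≤ q)
    (hp : f.a ≤ p) (hq : q ≤ f.b) :
    ∫ t in p..q, ‖f.d1 t‖ * Real.sin (f.angle α t - γ) =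
      height γ (f.toFun q) - height γ (f.toFun p) := by
  have hsub : Icc p q ⊆ Icc f.a f.b := Icc_subset_Icc hp hq
  have hL : ∀ z, height γ z = Complex.imCLM (Complex.exp (-(γ * Complex.I)) * z) := fun z => rfl
  refine intervalIntegral.integral_eq_sub_of_hasDerivAt_of_le
    (f := fun t => height γ (f.toFun t)) hpq ?_ ?_ ?_
  · simp only [hL]
    exact Complex.imCLM.continuous.comp_continuousOn
      (continuousOn_const.mul (hf.differentiableOn.continuousOn.mono hsub))
  · intro t ht
    have ht' : t ∈ Icc f.a f.b := hsub (Ioo_subset_Icc_self ht)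
    have hd : HasDerivAt f.toFun (f.d1 t) t :=
      (hf.hasDerivWithinAt ht').hasDerivAt (Icc_mem_nhds (hp.trans_lt ht.1) (ht.2.trans_le hq))
    have := Complex.imCLM.hasFDerivAt.comp_hasDerivAt t
      (hd.const_mul (Complex.exp (-(γ * Complex.I))))
    rw [← height_mul_exp, ← hf.d1_eq_norm_mul_exp_angle hα ht', hL]
    exact this
  · refine ContinuousOn.intervalIntegrable_of_Icc hpq ?_
    exact (hf.continuousOn_d1.mono hsub).norm.mul
      (Real.continuous_sin.comp_continuousOn
        (((hf.continuousOn_angle α).mono hsub).sub continuousOn_const))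

theorem intervalIntegrable_sqrt_sin_mul_turnRate (hf : f.IsCurve) (α γ : ℝ) {p q : ℝ}
    (hpq : p ≤ q) (hp : f.a ≤ p) (hq : q ≤ f.b) :
    IntervalIntegrable (fun t => √(Real.sin (f.angle α t - γ)) * f.turnRate t) volume p q := by
  refine (hf.intervalIntegrable_turnRate_of_mem ⟨hp, hpq.trans hq⟩
    ⟨hp.trans hpq, hq⟩).continuousOn_mul ?_
  rw [uIcc_of_le hpq]
  exact continuous_sqrt_sin.comp_continuousOn
    (((hf.continuousOn_angle α).mono (Icc_subset_Icc hp hq)).sub continuousOn_const)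

theorem integral_sqrt_sin_mul_turnRate (hf : f.IsCurve) (α γ : ℝ) {p q : ℝ} (hpq : p ≤ q)
    (hp : f.a ≤ p) (hq : q ≤ f.b) :
    ∫ t in p..q, √(Real.sin (f.angle α t - γ)) * f.turnRate t =
      sqrtSinIntegral (f.angle α q - γ) - sqrtSinIntegral (f.angle α p - γ) := by
  have hac : AbsolutelyContinuousOnInterval (fun t => sqrtSinIntegral (f.angle α t - γ)) p q :=
    ((hf.absolutelyContinuous_angle α).contDiff_comp (J := fun x => sqrtSinIntegral (x - γ))
      (contDiff_sqrtSinIntegral.comp (by fun_prop))).mono (by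
        rw [uIcc_of_le hpq, uIcc_of_le hf.lt.le]; exact Icc_subset_Icc hp hq)
  rw [← hac.integral_deriv_eq_sub]
  refine intervalIntegral.integral_congr_ae ?_
  filter_upwards [hf.ae_hasDerivAt_angle α] with t ht ht'
  rw [uIoc_of_le hpq] at ht'
  have h1 := ht (Icc_subset_Icc hp hq (Ioc_subset_Icc_self ht'))
  exact ((hasDerivAt_sqrtSinIntegral (f.angle α t - γ)).comp t (h1.sub_const γ)).deriv.symm

theorem _root_.ElasticSpline.Arc.intervalIntegrable_bend (h : IntegrableOn f.bend (Icc f.a f.b))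
    {p q : ℝ} (hpq : p ≤ q) (hp : f.a ≤ p) (hq : q ≤ f.b) :
    IntervalIntegrable f.bend volume p q := by
  rw [intervalIntegrable_iff_integrableOn_Icc_of_le hpq]
  exact h.mono_set (Icc_subset_Icc hp hq)

/-- Completing the square in the Lagrangian of the bending energy: an exact formula for the energy
of the part of a curve over `[p, q]` whose direction angles lie in `[γ, γ + π]`. -/
theorem integral_bend_eq (hf : f.IsCurve) {α : ℝ}
    (hα : f.d1 f.a / ‖f.d1 f.a‖ = Complex.exp (α * Complex.I))
    (hb : IntegrableOn f.bend (Icc f.a f.b)) {γ c ε : ℝ} (hε : ε ^ 2 = 1) {p q : ℝ} (hpq : p ≤ q)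
    (hp : f.a ≤ p) (hq : q ≤ f.b) (hθ : ∀ t ∈ Icc p q, 0 ≤ Real.sin (f.angle α t - γ)) :
    IntervalIntegrable (fun t => (f.curvature t / 2 + ε * c * √(Real.sin (f.angle α t - γ))) ^ 2
      * ‖f.d1 t‖) volume p q ∧
    1 / 4 * ∫ t in p..q, f.bend t =
      (∫ t in p..q, (f.curvature t / 2 + ε * c * √(Real.sin (f.angle α t - γ))) ^ 2 * ‖f.d1 t‖)
      - c ^ 2 * (height γ (f.toFun q) - height γ (f.toFun p))
      - ε * c * (sqrtSinIntegral (f.angle α q - γ) - sqrtSinIntegral (f.angle α p - γ)) := by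
  have i1 : IntervalIntegrable (fun t => 1 / 4 * f.bend t) volume p q :=
    (intervalIntegrable_bend hb hpq hp hq).const_mul _
  have i2 : IntervalIntegrable (fun t => c ^ 2 * (‖f.d1 t‖ * Real.sin (f.angle α t - γ)))
      volume p q := by
    have hsub : Icc p q ⊆ Icc f.a f.b := Icc_subset_Icc hp hq
    exact (ContinuousOn.intervalIntegrable_of_Icc hpq ((hf.continuousOn_d1.mono hsub).norm.mul
      (Real.continuous_sin.comp_continuousOn
        (((hf.continuousOn_angle α).mono hsub).sub continuousOn_const)))).const_mul _
  have i3 : IntervalIntegrable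
      (fun t => ε * c * (√(Real.sin (f.angle α t - γ)) * f.turnRate t)) volume p q :=
    (hf.intervalIntegrable_sqrt_sin_mul_turnRate α γ hpq hp hq).const_mul _
  -- The band hypothesis enters here: √x squares back to x only for x ≥ 0.
  have hpt : EqOn (fun t => 1 / 4 * f.bend t + c ^ 2 * (‖f.d1 t‖ * Real.sin (f.angle α t - γ))
        + ε * c * (√(Real.sin (f.angle α t - γ)) * f.turnRate t))
      (fun t => (f.curvature t / 2 + ε * c * √(Real.sin (f.angle α t - γ))) ^ 2 * ‖f.d1 t‖)
      (uIcc p q) := by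
    intro t ht
    rw [uIcc_of_le hpq] at ht
    have hs := Real.sq_sqrt (hθ t ht)
    simp only [bend, turnRate]
    rw [add_sq, mul_pow, mul_pow, hs, hε]
    ring
  refine ⟨((i1.add i2).add i3).congr fun t ht => hpt (uIoc_subset_uIcc ht), ?_⟩
  rw [← intervalIntegral.integral_congr hpt, intervalIntegral.integral_add (i1.add i2) i3,
    intervalIntegral.integral_add i1 i2]
  simp only [intervalIntegral.integral_const_mul]
  rw [hf.integral_norm_mul_sin hα γ hpq hp hq,
    hf.integral_sqrt_sin_mul_turnRate α γ hpq hp hq]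
  ring

/-- The square is dropped. The sign ε is free so that it can be adapted to the turning sense of each
half of an s-curve. -/
theorem le_integral_bend (hf : f.IsCurve) {α : ℝ}
    (hα : f.d1 f.a / ‖f.d1 f.a‖ = Complex.exp (α * Complex.I))
    (hb : IntegrableOn f.bend (Icc f.a f.b)) {γ c ε : ℝ} (hε : ε ^ 2 = 1) {p q : ℝ} (hpq : p ≤ q)
    (hp : f.a ≤ p) (hq : q ≤ f.b) (hθ : ∀ t ∈ Icc p q, 0 ≤ Real.sin (f.angle α t - γ)) :
    - c ^ 2 * (height γ (f.toFun q) - height γ (f.toFun p))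
      - ε * c * (sqrtSinIntegral (f.angle α q - γ) - sqrtSinIntegral (f.angle α p - γ)) ≤
    1 / 4 * ∫ t in p..q, f.bend t := by
  rw [(hf.integral_bend_eq hα hb (c := c) hε hpq hp hq hθ).2]
  have : 0 ≤ ∫ t in p..q,
      (f.curvature t / 2 + ε * c * √(Real.sin (f.angle α t - γ))) ^ 2 * ‖f.d1 t‖ :=
    intervalIntegral.integral_nonneg hpq fun t _ => by positivity
  linarith

end IsCurve

end Arc
end ElasticSpline

/-! ### Direction angles of s-curves and the comparison outside the band -/

namespace ElasticSpline
namespace Arc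

variable {f : Arc}

theorem d1_sub (hf : f.IsCurve) {p q : ℝ} (hpq : p < q) (hp : f.a ≤ p) (hq : q ≤ f.b) {t : ℝ}
    (ht : t ∈ Icc p q) : (f.sub p q).d1 t = f.d1 t :=
  ((hf.hasDerivWithinAt (Icc_subset_Icc hp hq ht)).mono (Icc_subset_Icc hp hq)).derivWithin
    (uniqueDiffOn_Icc hpq t ht)

/-- Restricted to interior points: at the ends of a sub-curve the second derivative is one-sided and
may differ from that of f. -/
theorem turnRate_sub (hf : f.IsCurve) {p q : ℝ} (hp : f.a ≤ p) (hq : q ≤ f.b) {t : ℝ}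
    (ht : t ∈ Ioo p q) : (f.sub p q).turnRate t = f.turnRate t := by
  have hpq := ht.1.trans ht.2
  have h1 := d1_sub hf hpq hp hq (Ioo_subset_Icc_self ht)
  have h2 : (f.sub p q).d2 t = f.d2 t := by
    have e : (f.sub p q).d1 =ᶠ[nhds t] f.d1 := by
      filter_upwards [Ioo_mem_nhds ht.1 ht.2] with x hx
      exact d1_sub hf hpq hp hq (Ioo_subset_Icc_self hx)
    change derivWithin (f.sub p q).d1 (Icc p q) t = derivWithin f.d1 (Icc f.a f.b) t
    rw [derivWithin_of_mem_nhds (Icc_mem_nhds ht.1 ht.2),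
      derivWithin_of_mem_nhds (Icc_mem_nhds (hp.trans_lt ht.1) (ht.2.trans_le hq)), e.deriv_eq]
  rw [turnRate_eq, turnRate_eq, h1, h2]

theorem turning_sub (hf : f.IsCurve) (α : ℝ) {p q : ℝ} (hpq : p < q) (hp : f.a ≤ p)
    (hq : q ≤ f.b) : (f.sub p q).turning = f.angle α q - f.angle α p := by
  rw [hf.angle_sub α ⟨hp, hpq.le.trans hq⟩ ⟨hp.trans hpq.le, hq⟩]
  change ∫ t in p..q, (f.sub p q).turnRate t = _
  refine intervalIntegral.integral_congr_ae ?_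
  have hne : ∀ᵐ t : ℝ, t ≠ q := by simp [ae_iff, measure_singleton]
  filter_upwards [hne] with t ht ht'
  rw [uIoc_of_le hpq.le] at ht'
  exact turnRate_sub hf hp hq ⟨ht'.1, lt_of_le_of_ne ht'.2 ht⟩

theorem IsLeftC.monotoneOn_angle (hf : f.IsCurve) (α : ℝ) {p q : ℝ}
    (hp : f.a ≤ p) (hq : q ≤ f.b) (h : (f.sub p q).IsLeftC) :
    MonotoneOn (f.angle α) (Icc p q) ∧ f.angle α q ≤ f.angle α p + Real.pi := by
  have hpq : p < q := h.1.lt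
  refine ⟨fun x hx y hy hxy => ?_, ?_⟩
  · have hx' := Icc_subset_Icc hp hq hx
    have hy' := Icc_subset_Icc hp hq hy
    rw [← sub_nonneg, hf.angle_sub α hx' hy']
    refine intervalIntegral.integral_nonneg_of_ae_restrict hxy ?_
    have hl : ∀ᵐ t ∂volume.restrict (Icc p q), 0 ≤ (f.sub p q).curvature t := h.2.1
    have hne : ∀ᵐ t : ℝ, t ≠ p ∧ t ≠ q := by
      have h1 : ∀ᵐ t : ℝ, t ≠ p := by simp [ae_iff, measure_singleton]
      have h2 : ∀ᵐ t : ℝ, t ≠ q := by simp [ae_iff, measure_singleton]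
      filter_upwards [h1, h2] with t a b using ⟨a, b⟩
    rw [ae_restrict_iff' measurableSet_Icc] at hl
    rw [Filter.EventuallyLE, ae_restrict_iff' measurableSet_Icc]
    filter_upwards [hl, hne] with t ht hne' ht'
    have htpq : t ∈ Icc p q := ⟨hx.1.trans ht'.1, ht'.2.trans hy.2⟩
    rw [← turnRate_sub hf hp hq ⟨lt_of_le_of_ne htpq.1 hne'.1.symm, lt_of_le_of_ne htpq.2 hne'.2⟩]
    exact mul_nonneg (ht htpq) (norm_nonneg _)
  · have h2 := h.2.2
    rw [turning_sub hf α hpq hp hq] at h2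
    linarith [(abs_le.mp h2).2]

theorem IsRightC.antitoneOn_angle (hf : f.IsCurve) (α : ℝ) {p q : ℝ}
    (hp : f.a ≤ p) (hq : q ≤ f.b) (h : (f.sub p q).IsRightC) :
    AntitoneOn (f.angle α) (Icc p q) ∧ f.angle α p - Real.pi ≤ f.angle α q := by
  have hpq : p < q := h.1.lt
  refine ⟨fun x hx y hy hxy => ?_, ?_⟩
  · have hx' := Icc_subset_Icc hp hq hx
    have hy' := Icc_subset_Icc hp hq hy
    rw [← sub_nonneg, ← neg_sub, hf.angle_sub α hx' hy', ← intervalIntegral.integral_neg]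
    refine intervalIntegral.integral_nonneg_of_ae_restrict hxy ?_
    have hl : ∀ᵐ t ∂volume.restrict (Icc p q), (f.sub p q).curvature t ≤ 0 := h.2.1
    have hne : ∀ᵐ t : ℝ, t ≠ p ∧ t ≠ q := by
      have h1 : ∀ᵐ t : ℝ, t ≠ p := by simp [ae_iff, measure_singleton]
      have h2 : ∀ᵐ t : ℝ, t ≠ q := by simp [ae_iff, measure_singleton]
      filter_upwards [h1, h2] with t a b using ⟨a, b⟩
    rw [ae_restrict_iff' measurableSet_Icc] at hl
    rw [Filter.EventuallyLE, ae_restrict_iff' measurableSet_Icc]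
    filter_upwards [hl, hne] with t ht hne' ht'
    have htpq : t ∈ Icc p q := ⟨hx.1.trans ht'.1, ht'.2.trans hy.2⟩
    rw [← turnRate_sub hf hp hq ⟨lt_of_le_of_ne htpq.1 hne'.1.symm, lt_of_le_of_ne htpq.2 hne'.2⟩]
    exact neg_nonneg.mpr (mul_nonpos_of_nonpos_of_nonneg (ht htpq) (norm_nonneg _))
  · have h2 := h.2.2
    rw [turning_sub hf α hpq hp hq] at h2
    linarith [(abs_le.mp h2).1]

/-- The final direction fixes the final angle modulo 2π, and β is the only representative within π
of α. -/
theorem angle_eq_of_abs_sub_le (hf : f.IsCurve) {α β : ℝ} (hβ : β < α) (hαβ : α - Real.pi < β)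
    (ha : f.d1 f.a / ‖f.d1 f.a‖ = Complex.exp (α * Complex.I))
    (hb : f.d1 f.b / ‖f.d1 f.b‖ = Complex.exp (β * Complex.I))
    (h1 : α - Real.pi ≤ f.angle α f.b) (h2 : f.angle α f.b ≤ α + Real.pi) :
    f.angle α f.b = β := by
  have hmem := right_mem_Icc.mpr hf.lt.le
  have h3 := hf.d1_eq_norm_mul_exp_angle ha hmem
  have hn : (‖f.d1 f.b‖ : ℂ) ≠ 0 := by simpa using hf.d1_ne_zero f.b hmem
  have h4 : Complex.exp (f.angle α f.b * Complex.I) = Complex.exp (β * Complex.I) := by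
    rw [← hb, eq_div_iff hn, mul_comm, ← h3]
  obtain ⟨n, hn⟩ := Complex.exp_eq_exp_iff_exists_int.mp h4
  have h5 : f.angle α f.b = β + n * (2 * Real.pi) := by
    have : ((f.angle α f.b : ℝ) : ℂ) * Complex.I
        = ((β + n * (2 * Real.pi) : ℝ) : ℂ) * Complex.I := by
      rw [hn]; push_cast; ring
    exact_mod_cast mul_right_cancel₀ Complex.I_ne_zero this
  have hpi := Real.pi_pos
  have hn1 : n < 1 := by
    by_contra! hc
    have : (1 : ℝ) ≤ n := by exact_mod_cast hc
    nlinarith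
  have hn2 : -1 < n := by
    by_contra! hc
    have : (n : ℝ) ≤ -1 := by exact_mod_cast hc
    nlinarith
  have : n = 0 := by omega
  simpa [this] using h5

end Arc

open Arc

/-- The bending energy of the elastic c-curve given by a multiplier. -/
noncomputable def multiplierEnergy (α β γ c : ℝ) : ℝ :=
  c * (sqrtSinIntegral (α - γ) - sqrtSinIntegral (β - γ)) + c ^ 2 * Real.sin γ

theorem sin_sub_nonneg_of_mem {γ x : ℝ} (h : x ∈ Icc γ (γ + Real.pi)) : 0 ≤ Real.sin (x - γ) :=
  Real.sin_nonneg_of_nonneg_of_le_pi (by linarith [h.1]) (by linarith [h.2])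

theorem integral_bend_eq_multiplierEnergy_add {f : Arc} {α β γ c : ℝ} (hf : f.IsCurve)
    (ha : f.tangent f.a = (0, Complex.exp (α * Complex.I))) (hb : f.toFun f.b = 1)
    (hβ : f.angle α f.b = β) (hint : IntegrableOn f.bend (Icc f.a f.b))
    (hθ : ∀ t ∈ Icc f.a f.b, f.angle α t ∈ Icc γ (γ + Real.pi)) :
    IntervalIntegrable (fun t => (f.curvature t / 2 + c * √(Real.sin (f.angle α t - γ))) ^ 2
      * ‖f.d1 t‖) volume f.a f.b ∧
    1 / 4 * ∫ t in f.a..f.b, f.bend t = multiplierEnergy α β γ c +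
      ∫ t in f.a..f.b, (f.curvature t / 2 + c * √(Real.sin (f.angle α t - γ))) ^ 2 * ‖f.d1 t‖ := by
  simp only [tangent, Prod.mk.injEq] at ha
  have := hf.integral_bend_eq ha.2 hint (c := c) (ε := 1) (γ := γ) (by norm_num) hf.lt.le le_rfl
    le_rfl fun t ht => sin_sub_nonneg_of_mem (hθ t ht)
  simp only [one_mul] at this
  refine ⟨this.1, ?_⟩
  rw [this.2, ha.1, hb, hβ, angle_left, height_one, height_zero, multiplierEnergy]
  ring

/-- A single left c-curve is impossible, since its final angle would be at least α > β. A right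
c-curve has its angles in [β, α], inside the band. A two-piece curve is governed by its angle p at
the junction. -/
theorem mem_band_or_multiplierEnergy_lt {α β γ c : ℝ} (h : IsMultiplier α β γ c) {f : Arc}
    (hf : f ∈ sCurves (0, Complex.exp (α * Complex.I)) (1, Complex.exp (β * Complex.I)))
    (hint : IntegrableOn f.bend (Icc f.a f.b)) :
    f.angle α f.b = β ∧ ((∀ t ∈ Icc f.a f.b, f.angle α t ∈ Icc γ (γ + Real.pi)) ∨
      multiplierEnergy α β γ c < 1 / 4 * ∫ t in f.a..f.b, f.bend t) := by
  obtain ⟨⟨hcurve, hcases⟩, ha, hb⟩ := hf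
  simp only [tangent, Prod.mk.injEq] at ha hb
  have hpi := Real.pi_pos
  have hlt := hcurve.lt
  have hγα := h.lt_γ
  have hγβ := h.γ_le
  have hα0 := h.α_pos
  have hβ0 := h.β_neg
  have hc := h.c_pos
  have ham : f.a ∈ Icc f.a f.b := left_mem_Icc.mpr hlt.le
  have hbm : f.b ∈ Icc f.a f.b := right_mem_Icc.mpr hlt.le
  have hend := angle_eq_of_abs_sub_le hcurve (by linarith) (by linarith) ha.2 hb.2
  have hangle_a : f.angle α f.a = α := angle_left f α
  rcases hcases with hl | hr | ⟨s, hs, ⟨hl, hr⟩ | ⟨hr, hl⟩⟩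
  · exfalso
    obtain ⟨h1, h2⟩ := IsLeftC.monotoneOn_angle hcurve α le_rfl le_rfl hl
    have h3 := h1 ham hbm hlt.le
    rw [hangle_a] at h2 h3
    have := hend (by linarith) h2
    linarith
  · obtain ⟨h1, h2⟩ := IsRightC.antitoneOn_angle hcurve α le_rfl le_rfl hr
    have h3 := h1 ham hbm hlt.le
    rw [hangle_a] at h2 h3
    have h4 := hend (by linarith) (by linarith)
    refine ⟨h4, Or.inl fun t ht => ?_⟩
    have h5 := h1 ham ht ht.1
    have h6 := h1 ht hbm ht.2
    rw [hangle_a] at h5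
    exact ⟨by linarith, by linarith⟩
  · obtain ⟨l1, l2⟩ := IsLeftC.monotoneOn_angle hcurve α le_rfl hs.2.le hl
    obtain ⟨r1, r2⟩ := IsRightC.antitoneOn_angle hcurve α hs.1.le le_rfl hr
    have l3 := l1 (left_mem_Icc.mpr hs.1.le) (right_mem_Icc.mpr hs.1.le) hs.1.le
    have r3 := r1 (left_mem_Icc.mpr hs.2.le) (right_mem_Icc.mpr hs.2.le) hs.2.le
    rw [hangle_a] at l2 l3
    have h4 := hend (by linarith) (by linarith)
    set p := f.angle α s with hp
    have hθl : ∀ t ∈ Icc f.a s, f.angle α t ∈ Icc α p := fun t ht =>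
      ⟨hangle_a.symm.le.trans (l1 (left_mem_Icc.mpr hs.1.le) ht ht.1), l1 ht (right_mem_Icc.mpr hs.1.le) ht.2⟩
    have hθr : ∀ t ∈ Icc s f.b, f.angle α t ∈ Icc β p := fun t ht =>
      ⟨h4 ▸ r1 ht (right_mem_Icc.mpr hs.2.le) ht.2, r1 (left_mem_Icc.mpr hs.2.le) ht ht.1⟩
    refine ⟨h4, ?_⟩
    rcases le_or_gt p (γ + Real.pi) with hpγ | hpγ
    · left
      intro t ht
      rcases le_total t s with hts | hts
      · have := hθl t ⟨ht.1, hts⟩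
        exact ⟨by linarith [this.1], by linarith [this.2]⟩
      · have := hθr t ⟨hts, ht.2⟩
        exact ⟨by linarith [this.1], by linarith [this.2]⟩
    · right
      -- The band [p - π, p] has the peak angle on its upper edge, and contains all angles because
      -- the right-turning half turns by at most π. The sign is ε = -1 on the left-turning half and
      -- 1 on the other.
      have k1 := hcurve.le_integral_bend ha.2 hint (γ := p - Real.pi) (c := c) (ε := -1)
        (by norm_num) hs.1.le le_rfl hs.2.le fun t ht => sin_sub_nonneg_of_mem
          ⟨by linarith [(hθl t ht).1], by linarith [(hθl t ht).2]⟩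
      have k2 := hcurve.le_integral_bend ha.2 hint (γ := p - Real.pi) (c := c) (ε := 1)
        (by norm_num) hs.2.le hs.1.le le_rfl fun t ht => sin_sub_nonneg_of_mem
          ⟨by linarith [(hθr t ht).1], by linarith [(hθr t ht).2]⟩
      have k3 := intervalIntegral.integral_add_adjacent_intervals
        (intervalIntegrable_bend hint hs.1.le le_rfl hs.2.le)
        (intervalIntegrable_bend hint hs.2.le hs.1.le le_rfl)
      have k4 := h.lt_of_turning_above (γ' := p - Real.pi) (by linarith) (by linarith)
      rw [← k3, multiplierEnergy]
      rw [hangle_a, ← hp, ha.1, height_zero] at k1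
      rw [h4, ← hp, hb.1, height_one] at k2
      have e : p - (p - Real.pi) = Real.pi := by ring
      rw [e] at k1 k2
      nlinarith [mul_lt_mul_of_pos_left k4 hc]
  · obtain ⟨l1, l2⟩ := IsLeftC.monotoneOn_angle hcurve α hs.1.le le_rfl hl
    obtain ⟨r1, r2⟩ := IsRightC.antitoneOn_angle hcurve α le_rfl hs.2.le hr
    have l3 := l1 (left_mem_Icc.mpr hs.2.le) (right_mem_Icc.mpr hs.2.le) hs.2.le
    have r3 := r1 (left_mem_Icc.mpr hs.1.le) (right_mem_Icc.mpr hs.1.le) hs.1.le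
    rw [hangle_a] at r2 r3
    have h4 := hend (by linarith) (by linarith)
    set p := f.angle α s with hp
    have hθr : ∀ t ∈ Icc f.a s, f.angle α t ∈ Icc p α := fun t ht =>
      ⟨r1 ht (right_mem_Icc.mpr hs.1.le) ht.2, (r1 (left_mem_Icc.mpr hs.1.le) ht ht.1).trans hangle_a.le⟩
    have hθl : ∀ t ∈ Icc s f.b, f.angle α t ∈ Icc p β := fun t ht =>
      ⟨l1 (left_mem_Icc.mpr hs.2.le) ht ht.1, h4 ▸ l1 ht (right_mem_Icc.mpr hs.2.le) ht.2⟩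
    refine ⟨h4, ?_⟩
    rcases le_or_gt γ p with hpγ | hpγ
    · left
      intro t ht
      rcases le_total t s with hts | hts
      · have := hθr t ⟨ht.1, hts⟩
        exact ⟨by linarith [this.1], by linarith [this.2]⟩
      · have := hθl t ⟨hts, ht.2⟩
        exact ⟨by linarith [this.1], by linarith [this.2]⟩
    · right
      -- Now the trough angle p is the lower edge of the band [p, p + π], so Y vanishes at the
      -- junction.
      have k1 := hcurve.le_integral_bend ha.2 hint (γ := p) (c := c) (ε := 1)
        (by norm_num) hs.1.le le_rfl hs.2.le fun t ht => sin_sub_nonneg_of_mem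
          ⟨by linarith [(hθr t ht).1], by linarith [(hθr t ht).2]⟩
      have k2 := hcurve.le_integral_bend ha.2 hint (γ := p) (c := c) (ε := -1)
        (by norm_num) hs.2.le hs.1.le le_rfl fun t ht => sin_sub_nonneg_of_mem
          ⟨by linarith [(hθl t ht).1], by linarith [(hθl t ht).2]⟩
      have k3 := intervalIntegral.integral_add_adjacent_intervals
        (intervalIntegrable_bend hint hs.1.le le_rfl hs.2.le)
        (intervalIntegrable_bend hint hs.2.le hs.1.le le_rfl)
      have k4 := h.lt_of_turning_below (γ' := p) (by linarith) hpγ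
      rw [← k3, multiplierEnergy]
      rw [hangle_a, ← hp, ha.1, height_zero, sub_self, sqrtSinIntegral_zero] at k1
      rw [h4, ← hp, hb.1, height_one, sub_self, sqrtSinIntegral_zero] at k2
      nlinarith [mul_lt_mul_of_pos_left k4 hc]

end ElasticSpline

/-! ### Rectangular elastica in terms of its direction angle -/

namespace ElasticSpline

theorem one_add_sin_sq_pos (t : ℝ) : 0 < 1 + Real.sin t ^ 2 := by positivity

/-- The direction angle of rectangular elastica. -/
noncomputable def elasticaAngle (t : ℝ) : ℝ := Real.pi / 2 - 2 * Real.arcsin (Real.cos t / √2)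

theorem cos_div_sqrt_two_sq (t : ℝ) : (Real.cos t / √2) ^ 2 = Real.cos t ^ 2 / 2 := by
  rw [div_pow, Real.sq_sqrt (by norm_num)]

theorem abs_cos_div_sqrt_two_lt (t : ℝ) : |Real.cos t / √2| < 1 := by
  rw [← sq_lt_one_iff_abs_lt_one, cos_div_sqrt_two_sq]
  nlinarith [Real.sin_sq_add_cos_sq t, sq_nonneg (Real.sin t)]

theorem sqrt_two_mul_sqrt (t : ℝ) :
    √2 * √(1 - (Real.cos t / √2) ^ 2) = √(1 + Real.sin t ^ 2) := by
  rw [cos_div_sqrt_two_sq, ← Real.sqrt_mul (by norm_num)]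
  congr 1
  nlinarith [Real.sin_sq_add_cos_sq t]

theorem hasDerivAt_elasticaAngle (t : ℝ) :
    HasDerivAt elasticaAngle (2 * Real.sin t / √(1 + Real.sin t ^ 2)) t := by
  have hlt := abs_lt.mp (abs_cos_div_sqrt_two_lt t)
  have h1 := (Real.hasDerivAt_arcsin hlt.1.ne' hlt.2.ne).comp t
    ((Real.hasDerivAt_cos t).div_const √2)
  have h2 : HasDerivAt elasticaAngle _ t := (h1.const_mul 2).const_sub (Real.pi / 2)
  refine h2.congr_deriv ?_
  rw [← sqrt_two_mul_sqrt]
  field_simp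

theorem sin_elasticaAngle (t : ℝ) : Real.sin (elasticaAngle t) = Real.sin t ^ 2 := by
  have hlt := abs_lt.mp (abs_cos_div_sqrt_two_lt t)
  rw [elasticaAngle, Real.sin_pi_div_two_sub, Real.cos_two_mul, Real.cos_sq',
    Real.sin_arcsin hlt.1.le hlt.2.le, cos_div_sqrt_two_sq]
  nlinarith [Real.sin_sq_add_cos_sq t]

theorem cos_elasticaAngle (t : ℝ) :
    Real.cos (elasticaAngle t) = Real.cos t * √(1 + Real.sin t ^ 2) := by
  have hlt := abs_lt.mp (abs_cos_div_sqrt_two_lt t)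
  rw [elasticaAngle, Real.cos_pi_div_two_sub, Real.sin_two_mul, Real.cos_arcsin,
    Real.sin_arcsin hlt.1.le hlt.2.le, ← sqrt_two_mul_sqrt]
  have h2 : √2 * √2 = 2 := Real.mul_self_sqrt (by norm_num)
  have h3 : Real.cos t / √2 * 2 = Real.cos t * √2 := by
    rw [div_mul_eq_mul_div, div_eq_iff (by positivity), mul_assoc, h2]
  linear_combination √(1 - (Real.cos t / √2) ^ 2) * h3

theorem hasDerivAt_xi (t : ℝ) : HasDerivAt xi (Real.sin t ^ 2 / √(1 + Real.sin t ^ 2)) t := by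
  have hc : Continuous fun r : ℝ => Real.sin r ^ 2 / √(1 + Real.sin r ^ 2) :=
    Continuous.div (by fun_prop) (by fun_prop) fun r =>
      (Real.sqrt_pos.mpr (one_add_sin_sq_pos r)).ne'
  exact intervalIntegral.integral_hasDerivAt_right (hc.intervalIntegrable _ _)
    hc.stronglyMeasurable.stronglyMeasurableAtFilter hc.continuousAt

/-- The derivative of rectangular elastica. -/
noncomputable def elasticaDeriv (t : ℝ) : ℂ :=
  (Real.cos t : ℂ) + Complex.I * ((Real.sin t ^ 2 / √(1 + Real.sin t ^ 2) : ℝ) : ℂ)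

theorem hasDerivAt_elastica (t : ℝ) : HasDerivAt elastica (elasticaDeriv t) t :=
  (Real.hasDerivAt_sin t).ofReal_comp.add ((hasDerivAt_xi t).ofReal_comp.const_mul Complex.I)

theorem contDiff_elasticaDeriv : ContDiff ℝ 1 elasticaDeriv := by
  unfold elasticaDeriv
  refine ContDiff.add (Complex.ofRealCLM.contDiff.comp Real.contDiff_cos)
    (contDiff_const.mul (Complex.ofRealCLM.contDiff.comp ?_))
  refine (Real.contDiff_sin.pow 2).div ?_ fun t => (Real.sqrt_pos.mpr (one_add_sin_sq_pos t)).ne'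
  exact (contDiff_const.add (Real.contDiff_sin.pow 2)).sqrt fun t => (one_add_sin_sq_pos t).ne'

theorem elasticaDeriv_eq (t : ℝ) : elasticaDeriv t =
    ((1 / √(1 + Real.sin t ^ 2) : ℝ) : ℂ) * Complex.exp (elasticaAngle t * Complex.I) := by
  have h := (Real.sqrt_pos.mpr (one_add_sin_sq_pos t)).ne'
  rw [Complex.exp_mul_I, ← Complex.ofReal_cos, ← Complex.ofReal_sin, sin_elasticaAngle,
    cos_elasticaAngle]
  apply Complex.ext
  · simp only [elasticaDeriv, Complex.add_re, Complex.mul_re, Complex.ofReal_re, Complex.ofReal_im,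
      Complex.I_re, Complex.I_im, Complex.add_im, Complex.mul_im]
    field_simp
    ring
  · simp only [elasticaDeriv, Complex.add_re, Complex.mul_re, Complex.ofReal_re, Complex.ofReal_im,
      Complex.I_re, Complex.I_im, Complex.add_im, Complex.mul_im]
    field_simp
    ring

/-- The parameter in `[-π, 0]` at which rectangular elastica has direction angle `φ ∈ [0, π]`. -/
noncomputable def elasticaParam (φ : ℝ) : ℝ := -Real.arccos (√2 * Real.sin (Real.pi / 4 - φ / 2))

theorem sq_sqrt_two_mul_sin (φ : ℝ) :
    (√2 * Real.sin (Real.pi / 4 - φ / 2)) ^ 2 = 1 - Real.sin φ := by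
  have h := Real.cos_two_mul (Real.pi / 4 - φ / 2)
  rw [show 2 * (Real.pi / 4 - φ / 2) = Real.pi / 2 - φ by ring, Real.cos_pi_div_two_sub,
    Real.cos_sq'] at h
  rw [mul_pow, Real.sq_sqrt (by norm_num)]
  linarith

theorem abs_sqrt_two_mul_sin_le {φ : ℝ} (h : φ ∈ Icc 0 Real.pi) :
    |√2 * Real.sin (Real.pi / 4 - φ / 2)| ≤ 1 := by
  rw [← sq_le_one_iff_abs_le_one, sq_sqrt_two_mul_sin]
  linarith [Real.sin_nonneg_of_mem_Icc h]

theorem cos_elasticaParam {φ : ℝ} (h : φ ∈ Icc 0 Real.pi) :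
    Real.cos (elasticaParam φ) = √2 * Real.sin (Real.pi / 4 - φ / 2) := by
  have := abs_le.mp (abs_sqrt_two_mul_sin_le h)
  rw [elasticaParam, Real.cos_neg, Real.cos_arccos this.1 this.2]

theorem sin_elasticaParam (φ : ℝ) : Real.sin (elasticaParam φ) = -√(Real.sin φ) := by
  rw [elasticaParam, Real.sin_neg, Real.sin_arccos, sq_sqrt_two_mul_sin, sub_sub_cancel]

theorem elasticaAngle_elasticaParam {φ : ℝ} (h : φ ∈ Icc 0 Real.pi) :
    elasticaAngle (elasticaParam φ) = φ := by
  rw [elasticaAngle, cos_elasticaParam h, mul_div_cancel_left₀ _ (by positivity),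
    Real.arcsin_sin (by linarith [h.2, Real.pi_pos]) (by linarith [h.1, Real.pi_pos])]
  ring

theorem continuous_elasticaParam : Continuous elasticaParam := by
  unfold elasticaParam
  have := Real.continuous_arccos
  fun_prop

theorem elasticaParam_nonpos (φ : ℝ) : elasticaParam φ ≤ 0 :=
  neg_nonpos.mpr (Real.arccos_nonneg _)

theorem neg_pi_le_elasticaParam (φ : ℝ) : -Real.pi ≤ elasticaParam φ :=
  neg_le_neg (Real.arccos_le_pi _)

theorem strictAntiOn_elasticaParam : StrictAntiOn elasticaParam (Icc 0 Real.pi) := by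
  intro x hx y hy hxy
  have h1 := abs_le.mp (abs_sqrt_two_mul_sin_le hx)
  have h2 := abs_le.mp (abs_sqrt_two_mul_sin_le hy)
  refine neg_lt_neg (Real.strictAntiOn_arccos ⟨h2.1, h2.2⟩ ⟨h1.1, h1.2⟩ ?_)
  refine mul_lt_mul_of_pos_left (Real.strictMonoOn_sin ⟨?_, ?_⟩ ⟨?_, ?_⟩ ?_) (by positivity) <;>
  linarith [hx.1, hx.2, hy.1, hy.2, Real.pi_pos]

theorem neg_pi_lt_elasticaParam {φ : ℝ} (h0 : 0 ≤ φ) (h1 : φ < Real.pi) :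
    -Real.pi < elasticaParam φ :=
  (neg_pi_le_elasticaParam _).trans_lt
    (strictAntiOn_elasticaParam ⟨h0, h1.le⟩ ⟨Real.pi_pos.le, le_rfl⟩ h1)

theorem hasDerivAt_elasticaParam {φ : ℝ} (h : φ ∈ Ioo 0 Real.pi) :
    HasDerivAt elasticaParam
      (-√(1 + Real.sin (elasticaParam φ) ^ 2) / (2 * √(Real.sin φ))) φ := by
  have hs := Real.sin_pos_of_mem_Ioo h
  have hlt : |√2 * Real.sin (Real.pi / 4 - φ / 2)| < 1 := by
    rw [← sq_lt_one_iff_abs_lt_one, sq_sqrt_two_mul_sin]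
    linarith
  have hlt' := abs_lt.mp hlt
  have h1 : HasDerivAt (fun φ => √2 * Real.sin (Real.pi / 4 - φ / 2))
      (√2 * (Real.cos (Real.pi / 4 - φ / 2) * (-(1 / 2)))) φ :=
    ((((hasDerivAt_id φ).div_const 2).const_sub (Real.pi / 4)).sin).const_mul √2
  have h2 := (Real.hasDerivAt_arccos hlt'.1.ne' hlt'.2.ne).comp φ h1
  have h3 : HasDerivAt elasticaParam _ φ := h2.neg
  refine h3.congr_deriv ?_
  -- Both sides square to 1 + sin φ, by the half-angle formula.
  have hcos : √(1 + Real.sin (elasticaParam φ) ^ 2) = √2 * Real.cos (Real.pi / 4 - φ / 2) := by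
    have hc : 0 ≤ Real.cos (Real.pi / 4 - φ / 2) :=
      Real.cos_nonneg_of_mem_Icc ⟨by linarith [h.2, Real.pi_pos], by linarith [h.1, Real.pi_pos]⟩
    rw [Real.sqrt_eq_iff_eq_sq (by positivity) (by positivity), sin_elasticaParam, neg_sq,
      Real.sq_sqrt hs.le, mul_pow, Real.cos_sq', mul_sub, ← mul_pow, sq_sqrt_two_mul_sin,
      Real.sq_sqrt (by norm_num)]
    ring
  rw [hcos, sq_sqrt_two_mul_sin, sub_sub_cancel]
  have := (Real.sqrt_pos.mpr hs).ne'
  field_simp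

/-- With φ = `elasticaAngle`, the sum ξ + Y(φ)/2 is constant on [-π, 0], since there √sin φ = |sin
t| = -sin t. -/
theorem xi_elasticaParam_sub {x y : ℝ} (hx : x ∈ Icc 0 Real.pi) (hy : y ∈ Icc 0 Real.pi)
    (hxy : x ≤ y) : xi (elasticaParam x) - xi (elasticaParam y) =
      1 / 2 * (sqrtSinIntegral y - sqrtSinIntegral x) := by
  set F : ℝ → ℝ := fun t => xi t + 1 / 2 * sqrtSinIntegral (elasticaAngle t)
  have hF : ∀ t, HasDerivAt F (Real.sin t ^ 2 / √(1 + Real.sin t ^ 2) +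
      1 / 2 * (√(Real.sin (elasticaAngle t)) * (2 * Real.sin t / √(1 + Real.sin t ^ 2)))) t :=
    fun t => (hasDerivAt_xi t).add (((hasDerivAt_sqrtSinIntegral _).comp t
      (hasDerivAt_elasticaAngle t)).const_mul _)
  have hle : elasticaParam y ≤ elasticaParam x := strictAntiOn_elasticaParam.antitoneOn hx hy hxy
  have hconst := constant_of_has_deriv_right_zero (f := F) (a := elasticaParam y)
    (b := elasticaParam x) (fun t _ => (hF t).continuousAt.continuousWithinAt) fun t ht => by
      refine (hF t).hasDerivWithinAt.congr_deriv ?_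
      have hs : Real.sin t ≤ 0 := Real.sin_nonpos_of_nonpos_of_neg_pi_le
        (ht.2.le.trans (elasticaParam_nonpos x)) ((neg_pi_le_elasticaParam y).trans ht.1)
      rw [sin_elasticaAngle, Real.sqrt_sq_eq_abs, abs_of_nonpos hs]
      ring
  have := hconst _ ⟨hle, le_rfl⟩
  simp only [F, elasticaAngle_elasticaParam hx, elasticaAngle_elasticaParam hy] at this
  linarith

end ElasticSpline

/-! ### The elastic arc: membership, energy and similarity -/

namespace ElasticSpline
open Arc

/-- The elastic c-curve given by a multiplier: a segment of rectangular elastica, scaled by `1 / c`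
and rotated by `γ`, starting at the origin. -/
noncomputable def elasticArc (α β γ c : ℝ) : Arc where
  a := elasticaParam (α - γ)
  b := elasticaParam (β - γ)
  toFun t := Complex.exp (γ * Complex.I) / c * (elastica t - elastica (elasticaParam (α - γ)))

theorem sin_nonpos_of_mem_elasticArc {α β γ c t : ℝ} (ht : t ∈ Icc (elasticArc α β γ c).a (elasticArc α β γ c).b) :
    Real.sin t ≤ 0 :=
  Real.sin_nonpos_of_nonpos_of_neg_pi_le (ht.2.trans (elasticaParam_nonpos _))
    ((neg_pi_le_elasticaParam _).trans ht.1)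

theorem elasticArc_left (α β γ c : ℝ) :
    (elasticArc α β γ c).toFun (elasticArc α β γ c).a = 0 := by
  simp [elasticArc]

namespace IsMultiplier

variable {α β γ c : ℝ} (h : IsMultiplier α β γ c)
include h

theorem sub_mem_α : α - γ ∈ Icc 0 Real.pi :=
  ⟨by linarith [h.γ_le, h.β_neg, h.α_pos], by linarith [h.lt_γ]⟩

theorem sub_mem_β : β - γ ∈ Icc 0 Real.pi :=
  ⟨by linarith [h.γ_le], by linarith [h.lt_γ, h.β_neg, h.α_pos]⟩

theorem elasticArc_lt : (elasticArc α β γ c).a < (elasticArc α β γ c).b :=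
  strictAntiOn_elasticaParam h.sub_mem_β h.sub_mem_α (by linarith [h.β_neg, h.α_pos])

theorem hasDerivAt_elasticArc (t : ℝ) :
    HasDerivAt (elasticArc α β γ c).toFun (((1 / √(1 + Real.sin t ^ 2) / c : ℝ) : ℂ) *
      Complex.exp ((elasticaAngle t + γ : ℝ) * Complex.I)) t := by
  have hc : (c : ℂ) ≠ 0 := by exact_mod_cast h.c_pos.ne'
  refine (((hasDerivAt_elastica t).sub_const _).const_mul _).congr_deriv ?_
  rw [elasticaDeriv_eq, Complex.ofReal_add, add_mul, Complex.exp_add, Complex.ofReal_div _ c]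
  field_simp

theorem d1_elasticArc {t : ℝ} (ht : t ∈ Icc (elasticArc α β γ c).a (elasticArc α β γ c).b) :
    (elasticArc α β γ c).d1 t = ((1 / √(1 + Real.sin t ^ 2) / c : ℝ) : ℂ) *
      Complex.exp ((elasticaAngle t + γ : ℝ) * Complex.I) :=
  (h.hasDerivAt_elasticArc t).hasDerivWithinAt.derivWithin (uniqueDiffOn_Icc h.elasticArc_lt t ht)

theorem norm_d1_elasticArc {t : ℝ}
    (ht : t ∈ Icc (elasticArc α β γ c).a (elasticArc α β γ c).b) :
    ‖(elasticArc α β γ c).d1 t‖ = 1 / √(1 + Real.sin t ^ 2) / c := by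
  have hc := h.c_pos
  rw [h.d1_elasticArc ht, norm_mul, Complex.norm_exp_ofReal_mul_I, mul_one, Complex.norm_real,
    Real.norm_of_nonneg (by positivity)]

theorem contDiffOn_d1_elasticArc : ContDiffOn ℝ 1 (elasticArc α β γ c).d1
    (Icc (elasticArc α β γ c).a (elasticArc α β γ c).b) := by
  have hcd : ContDiff ℝ 1 fun t => Complex.exp (γ * Complex.I) / c * elasticaDeriv t :=
    contDiff_const.mul contDiff_elasticaDeriv
  refine hcd.contDiffOn.congr fun t ht => ?_
  exact (((hasDerivAt_elastica t).sub_const _).const_mul _).hasDerivWithinAt.derivWithin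
    (uniqueDiffOn_Icc h.elasticArc_lt t ht)

theorem isCurve_elasticArc : (elasticArc α β γ c).IsCurve where
  lt := h.elasticArc_lt
  differentiableOn t _ := (h.hasDerivAt_elasticArc t).differentiableAt.differentiableWithinAt
  absolutelyContinuous := by
    refine ContDiffOn.absolutelyContinuousOnInterval ?_
    rw [uIcc_of_le h.elasticArc_lt.le]
    exact h.contDiffOn_d1_elasticArc
  d1_ne_zero t ht := by
    rw [← norm_ne_zero_iff, h.norm_d1_elasticArc ht]
    have := h.c_pos
    positivity

theorem turnRate_elasticArc {t : ℝ}
    (ht : t ∈ Icc (elasticArc α β γ c).a (elasticArc α β γ c).b) :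
    (elasticArc α β γ c).turnRate t = 2 * Real.sin t / √(1 + Real.sin t ^ 2) := by
  have hd := ((hasDerivAt_elasticaAngle t).add_const γ).hasDerivWithinAt
    (s := Icc (elasticArc α β γ c).a (elasticArc α β γ c).b)
  rw [turnRate, curvature_mul_speed h.isCurve_elasticArc (τ := fun t => elasticaAngle t + γ) ?_ ht
    (h.contDiffOn_d1_elasticArc.differentiableOn one_ne_zero t ht) hd.differentiableWithinAt]
  · exact hd.derivWithin (uniqueDiffOn_Icc h.elasticArc_lt t ht)
  · intro s hs
    rw [h.norm_d1_elasticArc hs, h.d1_elasticArc hs]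

/-- On the arc sin t = -√sin(θ - γ), so this is the extremal equation κ = -2c√sin(θ - γ). -/
theorem curvature_elasticArc {t : ℝ}
    (ht : t ∈ Icc (elasticArc α β γ c).a (elasticArc α β γ c).b) :
    (elasticArc α β γ c).curvature t = 2 * c * Real.sin t := by
  have h1 := h.turnRate_elasticArc ht
  rw [turnRate, h.norm_d1_elasticArc ht] at h1
  have hc := h.c_pos
  have hs := Real.sqrt_pos.mpr (one_add_sin_sq_pos t)
  field_simp at h1
  linarith

theorem angle_elasticArc {t : ℝ}
    (ht : t ∈ Icc (elasticArc α β γ c).a (elasticArc α β γ c).b) :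
    (elasticArc α β γ c).angle α t = elasticaAngle t + γ := by
  have h1 : ∫ r in (elasticArc α β γ c).a..t, (elasticArc α β γ c).turnRate r =
      elasticaAngle t - elasticaAngle (elasticArc α β γ c).a := by
    have e : EqOn (elasticArc α β γ c).turnRate (fun r => 2 * Real.sin r / √(1 + Real.sin r ^ 2))
        (uIcc (elasticArc α β γ c).a t) := fun r hr =>
      h.turnRate_elasticArc (by rw [uIcc_of_le ht.1] at hr; exact ⟨hr.1, hr.2.trans ht.2⟩)
    rw [intervalIntegral.integral_congr e]
    refine intervalIntegral.integral_eq_sub_of_hasDerivAt (fun r _ => hasDerivAt_elasticaAngle r) ?_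
    exact (Continuous.div (by fun_prop) (by fun_prop) fun r =>
      (Real.sqrt_pos.mpr (one_add_sin_sq_pos r)).ne').intervalIntegrable _ _
  rw [angle, h1, elasticArc, elasticaAngle_elasticaParam h.sub_mem_α]
  ring

theorem isRightC_elasticArc : (elasticArc α β γ c).IsRightC := by
  refine ⟨h.isCurve_elasticArc, ?_, ?_⟩
  · rw [IsRight, ae_restrict_iff' measurableSet_Icc]
    refine Filter.Eventually.of_forall fun t ht => ?_
    rw [h.curvature_elasticArc ht]
    nlinarith [sin_nonpos_of_mem_elasticArc ht, h.c_pos]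
  · have h1 := turning_sub h.isCurve_elasticArc α h.elasticArc_lt le_rfl le_rfl
    change (elasticArc α β γ c).turning = _ at h1
    rw [h1, h.angle_elasticArc (right_mem_Icc.mpr h.elasticArc_lt.le), angle_left, elasticArc,
      elasticaAngle_elasticaParam h.sub_mem_β, abs_le]
    constructor <;> linarith [h.lt_γ, h.γ_le, h.α_pos, h.β_neg, Real.pi_pos]

/-- The unscaled chord is c e^{-iγ}, by the two multiplier equations; scaling by 1/c and rotating by
γ turns it into 1. -/
theorem elasticArc_right : (elasticArc α β γ c).toFun (elasticArc α β γ c).b = 1 := by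
  have hc : (c : ℂ) ≠ 0 := by exact_mod_cast h.c_pos.ne'
  have h1 : elastica (elasticaParam (β - γ)) - elastica (elasticaParam (α - γ)) =
      c * Complex.exp (-(γ * Complex.I)) := by
    have h2 := xi_elasticaParam_sub h.sub_mem_β h.sub_mem_α (by linarith [h.β_neg, h.α_pos])
    rw [← h.sin_eq] at h2
    rw [← neg_mul, ← Complex.ofReal_neg, Complex.exp_mul_I, ← Complex.ofReal_cos,
      ← Complex.ofReal_sin, Real.cos_neg, Real.sin_neg]
    have h3 := h.cos_eq
    apply Complex.ext
    · simp [elastica, sin_elasticaParam, Complex.cos_ofReal_re]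
      linarith
    · simp [elastica, Complex.sin_ofReal_re]
      linarith
  simp only [elasticArc]
  rw [h1, Complex.exp_neg]
  have := Complex.exp_ne_zero (γ * Complex.I)
  field_simp

theorem elasticArc_mem_sCurves : elasticArc α β γ c ∈
    sCurves (0, Complex.exp (α * Complex.I)) (1, Complex.exp (β * Complex.I)) := by
  have dir : ∀ t ∈ Icc (elasticArc α β γ c).a (elasticArc α β γ c).b,
      (elasticArc α β γ c).d1 t / ‖(elasticArc α β γ c).d1 t‖ =
        Complex.exp ((elasticaAngle t + γ : ℝ) * Complex.I) := by
    intro t ht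
    have hn : (‖(elasticArc α β γ c).d1 t‖ : ℂ) ≠ 0 := by
      simpa using h.isCurve_elasticArc.d1_ne_zero t ht
    rw [div_eq_iff hn, h.norm_d1_elasticArc ht, h.d1_elasticArc ht, mul_comm]
  refine ⟨⟨h.isCurve_elasticArc, Or.inr (Or.inl h.isRightC_elasticArc)⟩, ?_, ?_⟩
  · rw [tangent, dir _ (left_mem_Icc.mpr h.elasticArc_lt.le), elasticArc_left, elasticArc,
      elasticaAngle_elasticaParam h.sub_mem_α, sub_add_cancel]
  · rw [tangent, dir _ (right_mem_Icc.mpr h.elasticArc_lt.le), h.elasticArc_right, elasticArc,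
      elasticaAngle_elasticaParam h.sub_mem_β, sub_add_cancel]

theorem integrableOn_bend_elasticArc : IntegrableOn (elasticArc α β γ c).bend
    (Icc (elasticArc α β γ c).a (elasticArc α β γ c).b) := by
  refine ContinuousOn.integrableOn_Icc ?_
  have hc : ContinuousOn (fun t => (2 * c * Real.sin t) ^ 2 * ‖(elasticArc α β γ c).d1 t‖)
      (Icc (elasticArc α β γ c).a (elasticArc α β γ c).b) :=
    ContinuousOn.mul (by fun_prop) h.isCurve_elasticArc.continuousOn_d1.norm
  exact hc.congr fun t ht => by rw [bend, h.curvature_elasticArc ht]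

/-- The arc stays in the band and its completed square vanishes identically. -/
theorem energy_elasticArc : (elasticArc α β γ c).energy =
    ENNReal.ofReal (multiplierEnergy α β γ c) := by
  have hb := right_mem_Icc.mpr h.elasticArc_lt.le
  have hend : (elasticArc α β γ c).angle α (elasticArc α β γ c).b = β := by
    rw [h.angle_elasticArc hb, elasticArc, elasticaAngle_elasticaParam h.sub_mem_β]
    ring
  rw [h.isCurve_elasticArc.energy_eq h.integrableOn_bend_elasticArc]
  congr 1
  have hS := h.elasticArc_mem_sCurves.2
  have hband : ∀ t ∈ Icc (elasticArc α β γ c).a (elasticArc α β γ c).b,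
      (elasticArc α β γ c).angle α t ∈ Icc γ (γ + Real.pi) := by
    intro t ht
    have hanti := (IsRightC.antitoneOn_angle h.isCurve_elasticArc α le_rfl le_rfl
      h.isRightC_elasticArc).1
    have h1 := hanti (left_mem_Icc.mpr h.elasticArc_lt.le) ht ht.1
    have h2 := hanti ht hb ht.2
    rw [angle_left] at h1
    rw [hend] at h2
    exact ⟨by linarith [h.γ_le], by linarith [h.lt_γ]⟩
  rw [(integral_bend_eq_multiplierEnergy_add h.isCurve_elasticArc hS.1 h.elasticArc_right
    hend h.integrableOn_bend_elasticArc (c := c) hband).2, add_eq_left]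
  rw [← intervalIntegral.integral_zero (a := (elasticArc α β γ c).a) (b := (elasticArc α β γ c).b)]
  refine intervalIntegral.integral_congr fun t ht => ?_
  rw [uIcc_of_le h.elasticArc_lt.le] at ht
  rw [h.curvature_elasticArc ht, h.angle_elasticArc ht, add_sub_cancel_right, sin_elasticaAngle,
    Real.sqrt_sq_eq_abs, abs_of_nonpos (sin_nonpos_of_mem_elasticArc ht)]
  ring

theorem directlySimilar_elasticArc :
    (elasticaSegment (elasticaParam (α - γ)) (elasticaParam (β - γ))).DirectlySimilar
      (elasticArc α β γ c) := by
  have hc : (c : ℂ) ≠ 0 := by exact_mod_cast h.c_pos.ne'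
  have hγ := Complex.exp_ne_zero (γ * Complex.I)
  refine ⟨c / Complex.exp (γ * Complex.I), elastica (elasticaParam (α - γ)), div_ne_zero hc hγ, ?_⟩
  have e : (elasticArc α β γ c).similarityMap (c / Complex.exp (γ * Complex.I))
      (elastica (elasticaParam (α - γ))) =
      elasticaSegment (elasticaParam (α - γ)) (elasticaParam (β - γ)) := by
    simp only [similarityMap, elasticaSegment, elasticArc, Arc.mk.injEq, true_and]
    funext t
    field_simp
    ring
  rw [e]
  exact ⟨rfl, fun _ _ => rfl⟩

end IsMultiplier
end ElasticSpline

/-! ### Arclength, reparametrization and uniqueness -/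

namespace ElasticSpline
namespace Arc

variable {f g : Arc}

theorem IsCurve.intervalIntegrable_norm_d1 (hf : f.IsCurve) {p q : ℝ} (hp : p ∈ Icc f.a f.b)
    (hq : q ∈ Icc f.a f.b) : IntervalIntegrable (fun t => ‖f.d1 t‖) volume p q := by
  refine ContinuousOn.intervalIntegrable (hf.continuousOn_d1.norm.mono ?_)
  rw [← uIcc_of_le hf.lt.le] at hp hq ⊢
  exact uIcc_subset_uIcc hp hq

theorem IsCurve.arclength_sub (hf : f.IsCurve) {p q : ℝ} (hp : p ∈ Icc f.a f.b)
    (hq : q ∈ Icc f.a f.b) : f.arclength q - f.arclength p = ∫ t in p..q, ‖f.d1 t‖ :=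
  intervalIntegral.integral_interval_sub_left
    (hf.intervalIntegrable_norm_d1 (left_mem_Icc.mpr hf.lt.le) hq)
    (hf.intervalIntegrable_norm_d1 (left_mem_Icc.mpr hf.lt.le) hp)

theorem IsCurve.strictMonoOn_arclength (hf : f.IsCurve) :
    StrictMonoOn f.arclength (Icc f.a f.b) := by
  intro p hp q hq hpq
  rw [← sub_pos, hf.arclength_sub hp hq]
  refine intervalIntegral.intervalIntegral_pos_of_pos_on (hf.intervalIntegrable_norm_d1 hp hq)
    (fun t ht => norm_pos_iff.mpr (hf.d1_ne_zero t ?_)) hpq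
  exact ⟨hp.1.trans ht.1.le, ht.2.le.trans hq.2⟩

theorem IsCurve.continuousOn_arclength (hf : f.IsCurve) :
    ContinuousOn f.arclength (Icc f.a f.b) := by
  have h := intervalIntegral.continuousOn_primitive_interval'
    (hf.intervalIntegrable_norm_d1 (left_mem_Icc.mpr hf.lt.le) (right_mem_Icc.mpr hf.lt.le))
    left_mem_uIcc
  rwa [uIcc_of_le hf.lt.le] at h

theorem IsCurve.hasDerivAt_arclength (hf : f.IsCurve) {t : ℝ} (ht : t ∈ Ioo f.a f.b) :
    HasDerivAt f.arclength ‖f.d1 t‖ t := by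
  have hnhds : Icc f.a f.b ∈ nhds t := Icc_mem_nhds ht.1 ht.2
  refine intervalIntegral.integral_hasDerivAt_right
    (hf.intervalIntegrable_norm_d1 (left_mem_Icc.mpr hf.lt.le) (Ioo_subset_Icc_self ht))
    ?_ (hf.continuousOn_d1.norm.continuousAt hnhds)
  exact ⟨Icc f.a f.b, hnhds, hf.continuousOn_d1.norm.aestronglyMeasurable measurableSet_Icc⟩

/-- A curve is equivalent to any curve of which it is a reparametrization. -/
theorem IsCurve.equivalent_of_comp (hf : f.IsCurve) (hg : g.IsCurve) {σ : ℝ → ℝ}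
    (hmaps : MapsTo σ (Icc g.a g.b) (Icc f.a f.b)) (hend : σ g.b = f.b)
    (hfun : ∀ t ∈ Icc g.a g.b, g.toFun t = f.toFun (σ t))
    (harc : ∀ t ∈ Icc g.a g.b, g.arclength t = f.arclength (σ t)) : g.Equivalent f := by
  refine ⟨by rw [len, len, harc _ (right_mem_Icc.mpr hg.lt.le), hend], fun s hs => ?_⟩
  have hs' : s ∈ Icc (g.arclength g.a) (g.arclength g.b) := by
    rwa [show g.arclength g.a = 0 by simp [arclength]]
  obtain ⟨t, ht, hts⟩ := intermediate_value_Icc hg.lt.le hg.continuousOn_arclength hs'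
  have hex : ∃ t ∈ Icc g.a g.b, g.arclength t = s := ⟨t, ht, hts⟩
  have hex' : ∃ t ∈ Icc f.a f.b, f.arclength t = s := ⟨σ t, hmaps ht, by rw [← harc t ht, hts]⟩
  have h1 := Function.invFunOn_mem hex
  have h2 := Function.invFunOn_eq hex
  have h3 := Function.invFunOn_mem hex'
  have h4 := Function.invFunOn_eq hex'
  rw [unitSpeed, unitSpeed, hfun _ h1]
  congr 1
  refine hf.strictMonoOn_arclength.injOn (hmaps h1) h3 ?_
  rw [← harc _ h1, h2, h4]

end Arc

open Arc

/-- Derivatives are required in the open interval only, because the reparametrization used below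
need not be differentiable where θ - γ reaches 0. -/
theorem eqOn_of_hasDerivAt_Ioo {E : Type*} [NormedAddCommGroup E] [NormedSpace ℝ E] [CompleteSpace E]
    {u v u' : ℝ → E} {a b : ℝ} (hu : ContinuousOn u (Icc a b)) (hv : ContinuousOn v (Icc a b))
    (hu' : ∀ t ∈ Ioo a b, HasDerivAt u (u' t) t) (hv' : ∀ t ∈ Ioo a b, HasDerivAt v (u' t) t)
    (hab : u a = v a) : EqOn u v (Icc a b) := by
  intro t ht
  have hD : ∀ x ∈ Ioo a b, HasDerivAt (u - v) 0 x := fun x hx => by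
    simpa using (hu' x hx).sub (hv' x hx)
  have hsub : Icc a t ⊆ Icc a b := Icc_subset_Icc_right ht.2
  have hint := intervalIntegral.integral_eq_sub_of_hasDerivAt_of_le ht.1
    ((hu.sub hv).mono hsub) (fun x hx => hD x ⟨hx.1, hx.2.trans_le ht.2⟩)
    intervalIntegrable_const
  rw [intervalIntegral.integral_zero] at hint
  simp only [Pi.sub_apply, hab, sub_self, sub_zero] at hint
  exact sub_eq_zero.mp hint.symm

theorem curvature_eq_of_integral_bend_eq {α β γ c : ℝ} {f : Arc} (hf : f.IsCurve)
    (ha : f.tangent f.a = (0, Complex.exp (α * Complex.I))) (hb : f.toFun f.b = 1)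
    (hβ : f.angle α f.b = β) (hint : IntegrableOn f.bend (Icc f.a f.b))
    (hθ : ∀ t ∈ Icc f.a f.b, f.angle α t ∈ Icc γ (γ + Real.pi))
    (heq : 1 / 4 * ∫ t in f.a..f.b, f.bend t = multiplierEnergy α β γ c) :
    ∀ᵐ t, t ∈ Ioc f.a f.b → f.curvature t = -(2 * c * √(Real.sin (f.angle α t - γ))) := by
  obtain ⟨h1, h2⟩ := integral_bend_eq_multiplierEnergy_add (c := c) hf ha hb hβ hint hθ
  rw [heq, left_eq_add, intervalIntegral.integral_of_le hf.lt.le, integral_eq_zero_iff_of_nonneg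
    (fun t => by positivity) h1.1, Filter.EventuallyEq, ae_restrict_iff' measurableSet_Ioc] at h2
  filter_upwards [h2] with t ht ht'
  have h3 := ht ht'
  have hn := norm_ne_zero_iff.mpr (hf.d1_ne_zero t (Ioc_subset_Icc_self ht'))
  simp only [Pi.zero_apply, mul_eq_zero, hn, or_false, ne_eq, OfNat.ofNat_ne_zero,
    not_false_eq_true, pow_eq_zero_iff] at h3
  linarith

namespace IsMultiplier

variable {α β γ c : ℝ} {f : Arc}

/-- A minimizer is a reparametrization of the elastic c-curve. -/
theorem equivalent_elasticArc (h : IsMultiplier α β γ c) (hf : f.IsCurve)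
    (ha : f.tangent f.a = (0, Complex.exp (α * Complex.I))) (hb : f.toFun f.b = 1)
    (hβ : f.angle α f.b = β)
    (hθ : ∀ t ∈ Icc f.a f.b, f.angle α t ∈ Icc γ (γ + Real.pi))
    (hκ : ∀ᵐ t, t ∈ Ioc f.a f.b → f.curvature t = -(2 * c * √(Real.sin (f.angle α t - γ)))) :
    f.Equivalent (elasticArc α β γ c) := by
  have hc := h.c_pos
  have ha' := ha
  simp only [tangent, Prod.mk.injEq] at ha'
  set θ := f.angle α with hθdef
  have hθa : θ f.a = α := angle_left f α
  have hθc : ContinuousOn θ (Icc f.a f.b) := hf.continuousOn_angle α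
  set ω : ℝ → ℝ := fun t => -(2 * c * √(Real.sin (θ t - γ))) * ‖f.d1 t‖ with hω
  have hωc : ContinuousOn ω (Icc f.a f.b) := by
    refine ContinuousOn.mul (ContinuousOn.neg (continuousOn_const.mul ?_)) hf.continuousOn_d1.norm
    exact continuous_sqrt_sin.comp_continuousOn (hθc.sub continuousOn_const)
  have hdiff : ∀ p ∈ Icc f.a f.b, ∀ q ∈ Icc f.a f.b, p ≤ q → θ q - θ p = ∫ t in p..q, ω t := by
    intro p hp q hq hpq
    rw [hf.angle_sub α hp hq]
    refine intervalIntegral.integral_congr_ae ?_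
    filter_upwards [hκ] with t ht ht'
    rw [uIoc_of_le hpq] at ht'
    rw [turnRate, ht ⟨hp.1.trans_lt ht'.1, ht'.2.trans hq.2⟩]
  -- The almost everywhere equation for κ has a continuous right side, so θ is differentiable at
  -- every interior point.
  have hθd : ∀ t ∈ Ioo f.a f.b, HasDerivAt θ (ω t) t := by
    intro t ht
    have hnhds : Icc f.a f.b ∈ nhds t := Icc_mem_nhds ht.1 ht.2
    have h1 : HasDerivAt (fun x => α + ∫ r in f.a..x, ω r) (ω t) t := by
      refine (intervalIntegral.integral_hasDerivAt_right ?_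
        ⟨Icc f.a f.b, hnhds, hωc.aestronglyMeasurable measurableSet_Icc⟩
        (hωc.continuousAt hnhds)).const_add α
      exact (hωc.mono (Icc_subset_Icc_right ht.2.le)).intervalIntegrable_of_Icc ht.1.le
    refine h1.congr_of_eventuallyEq ?_
    filter_upwards [hnhds] with x hx
    rw [← hdiff _ (left_mem_Icc.mpr hf.lt.le) x hx hx.1, hθa]
    ring
  have hanti : AntitoneOn θ (Icc f.a f.b) := by
    intro p hp q hq hpq
    rw [← sub_nonneg, ← neg_sub, hdiff p hp q hq hpq, ← intervalIntegral.integral_neg]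
    refine intervalIntegral.integral_nonneg hpq fun t _ => ?_
    have : 0 ≤ 2 * c * √(Real.sin (θ t - γ)) * ‖f.d1 t‖ := by positivity
    simp only [hω]
    linarith
  -- the first parameter at which the final direction is reached
  obtain ⟨s, ⟨hsm, hsβ⟩, hsmin⟩ : ∃ s, IsLeast {t ∈ Icc f.a f.b | θ t = β} s := by
    have hcl : IsCompact (Icc f.a f.b ∩ θ ⁻¹' {β}) :=
      isCompact_Icc.of_isClosed_subset (hθc.preimage_isClosed_of_isClosed isClosed_Icc
        isClosed_singleton) inter_subset_left
    exact hcl.exists_isLeast ⟨f.b, right_mem_Icc.mpr hf.lt.le, hβ⟩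
  have has : f.a < s := lt_of_le_of_ne hsm.1 fun e => by
    rw [← e, hθa] at hsβ
    linarith [h.α_pos, h.β_neg]
  have hθβ : ∀ t ∈ Icc f.a f.b, β ≤ θ t := fun t ht =>
    hβ ▸ hanti ht (right_mem_Icc.mpr hf.lt.le) ht.2
  have hθα : ∀ t ∈ Icc f.a f.b, θ t ≤ α := fun t ht =>
    hθa ▸ hanti (left_mem_Icc.mpr hf.lt.le) ht ht.1
  have hsub : Icc f.a s ⊆ Icc f.a f.b := Icc_subset_Icc_right hsm.2
  have hφ : ∀ t ∈ Ioo f.a s, θ t - γ ∈ Ioo 0 Real.pi := by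
    intro t ht
    have htm := hsub (Ioo_subset_Icc_self ht)
    have hne : θ t ≠ β := fun e => absurd (hsmin ⟨htm, e⟩) (not_le.mpr ht.2)
    have := lt_of_le_of_ne (hθβ t htm) hne.symm
    exact ⟨by linarith [h.γ_le], by linarith [h.lt_γ, hθα t htm]⟩
  have hstrict : StrictAntiOn θ (Icc f.a s) := by
    refine strictAntiOn_of_deriv_neg (convex_Icc _ _) (hθc.mono hsub) fun t ht => ?_
    rw [interior_Icc] at ht
    rw [(hθd t ⟨ht.1, ht.2.trans_le hsm.2⟩).deriv]
    have h1 := Real.sqrt_pos.mpr (Real.sin_pos_of_mem_Ioo (hφ t ht))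
    have h2 := norm_pos_iff.mpr (hf.d1_ne_zero t (hsub (Ioo_subset_Icc_self ht)))
    have : 0 < 2 * c * √(Real.sin (θ t - γ)) * ‖f.d1 t‖ := by positivity
    simp only [hω]
    linarith
  -- The change of parameter sends each point of f to the point of the elastic arc with the same
  -- direction.
  set σ : ℝ → ℝ := fun t => elasticaParam (θ t - γ) with hσ
  have hσc : ContinuousOn σ (Icc f.a f.b) :=
    continuous_elasticaParam.comp_continuousOn (hθc.sub continuousOn_const)
  have hφm : ∀ t ∈ Icc f.a f.b, θ t - γ ∈ Icc 0 Real.pi := fun t ht =>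
    ⟨by linarith [(hθ t ht).1], by linarith [(hθ t ht).2]⟩
  have hmaps : MapsTo σ (Icc f.a f.b) (Icc (elasticArc α β γ c).a (elasticArc α β γ c).b) :=
    fun t ht => ⟨strictAntiOn_elasticaParam.antitoneOn (hφm t ht) h.sub_mem_α
      (by linarith [hθα t ht]), strictAntiOn_elasticaParam.antitoneOn h.sub_mem_β (hφm t ht)
      (by linarith [hθβ t ht])⟩
  have hσd : ∀ t ∈ Ioo f.a s,
      HasDerivAt σ (c * √(1 + Real.sin (σ t) ^ 2) * ‖f.d1 t‖) t := by
    intro t ht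
    have h1 := (hasDerivAt_elasticaParam (hφ t ht)).comp t
      ((hθd t ⟨ht.1, ht.2.trans_le hsm.2⟩).sub_const γ)
    refine HasDerivAt.congr_deriv h1 ?_
    have hpos := (Real.sqrt_pos.mpr (Real.sin_pos_of_mem_Ioo (hφ t ht))).ne'
    simp only [hω, hσ]
    field_simp
  have hcurve := h.isCurve_elasticArc
  have hσa : σ f.a = (elasticArc α β γ c).a := by simp [hσ, hθa, elasticArc]
  have hσs : σ s = (elasticArc α β γ c).b := by simp [hσ, hsβ, elasticArc]
  have hfun : EqOn f.toFun (fun t => (elasticArc α β γ c).toFun (σ t)) (Icc f.a s) := by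
    refine eqOn_of_hasDerivAt_Ioo (u' := f.d1) (hf.differentiableOn.continuousOn.mono hsub) ?_ ?_ ?_ ?_
    · exact hcurve.differentiableOn.continuousOn.comp (hσc.mono hsub) (hmaps.mono_left hsub)
    · intro t ht
      exact (hf.hasDerivWithinAt (hsub (Ioo_subset_Icc_self ht))).hasDerivAt
        (Icc_mem_nhds ht.1 (ht.2.trans_le hsm.2))
    · intro t ht
      have htm := hsub (Ioo_subset_Icc_self ht)
      have h1 := (h.hasDerivAt_elasticArc (σ t)).scomp t (hσd t ht)
      refine HasDerivAt.congr_deriv h1 ?_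
      have e : elasticaAngle (σ t) + γ = θ t := by
        rw [hσ, elasticaAngle_elasticaParam (hφm t htm)]; ring
      rw [e, hf.d1_eq_norm_mul_exp_angle ha'.2 htm, Complex.real_smul, ← mul_assoc,
        ← Complex.ofReal_mul]
      congr 2
      have hpos := (Real.sqrt_pos.mpr (one_add_sin_sq_pos (σ t))).ne'
      rw [norm_mul, Complex.norm_exp_ofReal_mul_I, Complex.norm_real, norm_norm]
      field_simp
    · rw [hσa, elasticArc_left, ha'.1]
  have harc : EqOn f.arclength (fun t => (elasticArc α β γ c).arclength (σ t)) (Icc f.a s) := by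
    refine eqOn_of_hasDerivAt_Ioo (u' := fun t => ‖f.d1 t‖) (hf.continuousOn_arclength.mono hsub)
      ?_ ?_ ?_ ?_
    · exact hcurve.continuousOn_arclength.comp (hσc.mono hsub) (hmaps.mono_left hsub)
    · exact fun t ht => hf.hasDerivAt_arclength ⟨ht.1, ht.2.trans_le hsm.2⟩
    · intro t ht
      have htm := hsub (Ioo_subset_Icc_self ht)
      have hσm : σ t ∈ Ioo (elasticArc α β γ c).a (elasticArc α β γ c).b := by
        have hne : θ t ≠ β := fun e => absurd (hsmin ⟨htm, e⟩) (not_le.mpr ht.2)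
        have hneα : θ t < α := hθa ▸ hstrict (left_mem_Icc.mpr has.le) (Ioo_subset_Icc_self ht) ht.1
        exact ⟨strictAntiOn_elasticaParam (hφm t htm) h.sub_mem_α (by linarith),
          strictAntiOn_elasticaParam h.sub_mem_β (hφm t htm)
            (by linarith [lt_of_le_of_ne (hθβ t htm) hne.symm])⟩
      have h1 := (hcurve.hasDerivAt_arclength hσm).comp t (hσd t ht)
      refine HasDerivAt.congr_deriv h1 ?_
      rw [h.norm_d1_elasticArc (hmaps htm)]
      have hpos := (Real.sqrt_pos.mpr (one_add_sin_sq_pos (σ t))).ne'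
      field_simp
    · simp only [hσa]
      simp [arclength]
  -- If γ = β, the equation for θ is not Lipschitz at θ = β and admits the rest solution, so a
  -- straight piece has to be excluded. After s the direction is constantly β, and the displacement
  -- along it equals the length; but f is at 1 both at s and at the end.
  have hsb : s = f.b := by
    by_contra hne
    have hlt : s < f.b := lt_of_le_of_ne hsm.2 hne
    have h1 := hf.integral_norm_mul_sin ha'.2 (β - Real.pi / 2) hlt.le hsm.1 le_rfl
    have h2 : f.toFun s = 1 := by
      rw [hfun (right_mem_Icc.mpr has.le)]
      simp only [hσs, h.elasticArc_right]
    rw [hb, h2, sub_self] at h1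
    have h3 : ∫ t in s..f.b, ‖f.d1 t‖ * Real.sin (f.angle α t - (β - Real.pi / 2)) =
        ∫ t in s..f.b, ‖f.d1 t‖ := by
      refine intervalIntegral.integral_congr fun t ht => ?_
      rw [uIcc_of_le hlt.le] at ht
      have htm : t ∈ Icc f.a f.b := ⟨hsm.1.trans ht.1, ht.2⟩
      have : θ t = β := le_antisymm (hsβ ▸ hanti hsm htm ht.1) (hθβ t htm)
      rw [← hθdef, this]
      simp
    rw [h3, ← hf.arclength_sub hsm (right_mem_Icc.mpr hf.lt.le), sub_eq_zero] at h1
    exact (hf.strictMonoOn_arclength hsm (right_mem_Icc.mpr hf.lt.le) hlt).ne' h1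
  rw [hsb] at hfun harc hσs
  exact hcurve.equivalent_of_comp hf hmaps hσs hfun harc

end IsMultiplier
end ElasticSpline

/-! ### Minimality, uniqueness and the theorem -/

open ElasticSpline ElasticSpline.Arc in
theorem ElasticSpline.IsMultiplier.hasMinimalEnergy_elasticArc {α β γ c : ℝ}
    (h : IsMultiplier α β γ c) :
    HasMinimalEnergy (sCurves (0, Complex.exp (α * Complex.I)) (1, Complex.exp (β * Complex.I)))
      (elasticArc α β γ c) := by
  refine ⟨h.elasticArc_mem_sCurves, fun g hg => ?_⟩
  have hcurve := hg.1.1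
  by_cases htop : g.energy = ⊤
  · rw [htop]; exact le_top
  have hint := hcurve.integrableOn_bend htop
  rw [h.energy_elasticArc, hcurve.energy_eq hint]
  refine ENNReal.ofReal_le_ofReal ?_
  obtain ⟨hβ, hband | hlt⟩ := mem_band_or_multiplierEnergy_lt h hg hint
  · rw [(integral_bend_eq_multiplierEnergy_add (c := c) hcurve hg.2.1
      (congrArg Prod.fst hg.2.2) hβ hint hband).2]
    exact le_add_of_nonneg_right
      (intervalIntegral.integral_nonneg hcurve.lt.le fun t _ => by positivity)
  · exact hlt.le

open ElasticSpline ElasticSpline.Arc in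
theorem ElasticSpline.IsMultiplier.equivalent_of_hasMinimalEnergy {α β γ c : ℝ}
    (h : IsMultiplier α β γ c) {g : Arc}
    (hg : HasMinimalEnergy
      (sCurves (0, Complex.exp (α * Complex.I)) (1, Complex.exp (β * Complex.I))) g) :
    g.Equivalent (elasticArc α β γ c) := by
  obtain ⟨hg, hmin⟩ := hg
  have hcurve := hg.1.1
  have hle := hmin _ h.elasticArc_mem_sCurves
  rw [h.energy_elasticArc] at hle
  have hint := hcurve.integrableOn_bend (ne_top_of_le_ne_top ENNReal.ofReal_ne_top hle)
  -- Nonnegativity is needed because `ENNReal.ofReal` truncates negative numbers to 0. By the sine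
  -- equation the value is -c² sin γ.
  have hmpos : 0 ≤ multiplierEnergy α β γ c := by
    have h1 := h.sin_eq
    have h2 : 0 ≤ -Real.sin γ := by
      rw [← Real.sin_neg]
      exact Real.sin_nonneg_of_nonneg_of_le_pi (by linarith [h.γ_le, h.β_neg])
        (by linarith [h.lt_γ, h.α_pos])
    have h3 : multiplierEnergy α β γ c = c ^ 2 * -Real.sin γ := by
      rw [multiplierEnergy]
      linear_combination (-2 * c) * h1
    rw [h3]
    positivity
  rw [hcurve.energy_eq hint, ENNReal.ofReal_le_ofReal_iff hmpos] at hle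
  obtain ⟨hβ, hband | hlt⟩ := mem_band_or_multiplierEnergy_lt h hg hint
  · have hb1 : g.toFun g.b = 1 := congrArg Prod.fst hg.2.2
    have hge := (integral_bend_eq_multiplierEnergy_add (c := c) hcurve hg.2.1 hb1 hβ hint hband).2
    have hnn : 0 ≤ ∫ t in g.a..g.b,
        (g.curvature t / 2 + c * √(Real.sin (g.angle α t - γ))) ^ 2 * ‖g.d1 t‖ :=
      intervalIntegral.integral_nonneg hcurve.lt.le fun t _ => by positivity
    exact h.equivalent_elasticArc hcurve hg.2.1 hb1 hβ hband
      (curvature_eq_of_integral_bend_eq hcurve hg.2.1 hb1 hβ hint hband (by linarith))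
  · linarith

theorem theorem6p2 (α β : ℝ) (hα : α ∈ Set.Ioo 0 Real.pi) (hβ : β < 0) (hβα : |β| ≤ α)
    (hαβ : α - Real.pi < β) (hσ : ElasticSpline.sigma α β β ≤ 0) :
    ∃ t₁ t₂ : ℝ, -Real.pi < t₁ ∧ t₁ < t₂ ∧ t₂ ≤ 0 ∧
      ∃ f ∈ ElasticSpline.sCurves (0, Complex.exp (α * Complex.I)) (1, Complex.exp (β * Complex.I)),
        (ElasticSpline.elasticaSegment t₁ t₂).DirectlySimilar f ∧
        ElasticSpline.Arc.HasMinimalEnergy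
          (ElasticSpline.sCurves (0, Complex.exp (α * Complex.I)) (1, Complex.exp (β * Complex.I))) f ∧
        ∀ g, ElasticSpline.Arc.HasMinimalEnergy
          (ElasticSpline.sCurves (0, Complex.exp (α * Complex.I)) (1, Complex.exp (β * Complex.I))) g →
          g.Equivalent f := by
  obtain ⟨γ, c, h⟩ := ElasticSpline.exists_isMultiplier hα hβ hβα hαβ hσ
  exact ⟨ElasticSpline.elasticaParam (α - γ), ElasticSpline.elasticaParam (β - γ),
    ElasticSpline.neg_pi_lt_elasticaParam h.sub_mem_α.1 (by linarith [h.lt_γ]),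
    h.elasticArc_lt, ElasticSpline.elasticaParam_nonpos _,
    ElasticSpline.elasticArc α β γ c, h.elasticArc_mem_sCurves, h.directlySimilar_elasticArc,
    h.hasMinimalEnergy_elasticArc, fun _ hg => h.equivalent_of_hasMinimalEnergy hg⟩
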